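/- Let $T^2=\mathbb{R}^2/\mathbb{Z}^2$ be the torus, let $\mathcal T$ be a triangulation of $T^2$ with a single vertex, and let $\tilde{\mathcal T}$ be its lift to the universal cover $\mathbb{R}^2$, on which $\pi_1(T^2)=\mathbb{Z}^2$ acts by deck transformations; fix a lift $v_0$ of the vertex. Let $O$ be a left order (a translation-invariant total order $<$) on $\mathbb{Z}^2$. Call an action $\rho$ of $\mathbb{Z}^2$ on $\mathbb{R}$ by homeomorphisms *allowed for $O$* if $\rho(g)(0)<\rho(h)(0)\iff g<h$. An action $\rho$ determines a function $F:\mathbb{R}^2\to\mathbb{R}$ as follows. At vertices, $F(gv_0)=\rho(g)(0)$. On an edge of $\tilde{\mathcal T}$ whose endpoint with the larger value of $F$ is $v_0$, $F$ is linear; on an edge whose endpoint with the larger value is $gv_0$, $F(x)=\rho(g)(F(g^{-1}x))$. On each triangle, $F$ is extended so that each level set in the triangle is the convex hull of the points of that level on the boundary of the triangle (linearity and convexity refer to the PL structure given by $\tilde{\mathcal T}$). The images in $T^2$ of the connected components of the level sets of $F$ are the leaves of a singular foliation $\mathcal F(\mathcal T,\rho)$. A leaf is *closed* if it is a simple closed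 curve (homeomorphic to a circle). The fLOiation $F_O$ of $O$ is $\mathcal F(\mathcal T,\rho_{i_0})$, where, for an enumeration $\mathbb{Z}^2=\{s_0,s_1,\dots\}$ with $s_0=0$, the minimal embedding $i_0:\mathbb{Z}^2\to\mathbb{R}$ is defined inductively by $i_0(s_0)=0$; $i_0(s_n)=\max_{p<n}i_0(s_p)+1$ if $s_n$ is larger than all $s_p$, $p<n$; $i_0(s_n)=\min_{p<n}i_0(s_p)-1$ if it is smaller than all of them; and otherwise $i_0(s_n)$ is the midpoint of the values of $i_0$ at the two closest neighbours of $s_n$ among $s_0,\dots,s_{n-1}$. The action $\rho_{i_0}$ is given by $\rho_{i_0}(g)(i_0(h))=i_0(g+h)$ on the image of $i_0$, extended continuously to the closure of the image and linearly to the complementary intervals. Then, for every choice of $\mathcal T$ and of the enumeration, $F_O$ has a closed leaf if and only if $O$ is not Archimedean. The same equivalence holds for $\mathcal F(\mathcal T,\rho)$ for every action $\rho$ that is allowed for $O$. -/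

import Mathlib

/-- The group `ℤ²` of deck transformations of the universal cover of the torus, i.e. `π₁(T²)`.
It is a type of its own, so that it carries no preferred order. -/
def Deck : Type := ℤ × ℤ

instance Deck.instAddCommGroup : AddCommGroup Deck := inferInstanceAs (AddCommGroup (ℤ × ℤ))

namespace FLOiation

/-- The universal cover of the torus. -/
abbrev Plane : Type := ℝ × ℝ

/-- The torus `S¹ × S¹ = ℝ² / ℤ²`. -/
abbrev Torus : Type := UnitAddCircle × UnitAddCircle

/-- The universal covering map. -/
def cover (x : Plane) : Torus := ((x.1 : UnitAddCircle), (x.2 : UnitAddCircle))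

/-- The lattice point `g · 0`; the deck transformation `g` is the translation by it. -/
def pt (g : Deck) : Plane := ((g.1 : ℝ), (g.2 : ℝ))

/-- A triangulation of the torus with a single vertex, given by its lift to the universal cover:
a `ℤ²`-invariant simplicial complex with underlying space `ℝ²` whose vertices form the single
orbit `ℤ²`, together with a homeomorphism, commuting with the deck transformations, that maps the
straight simplices of the complex onto the actual (possibly curved) simplices of the lifted
triangulation. -/
structure OneVertexTriangulation where
  complex : Geometry.SimplicialComplex ℝ Plane
  vertices_eq : complex.vertices = Set.range pt
  space_eq : complex.space = Set.univ
  invariant : ∀ (g : Deck), ∀ s ∈ complex.faces,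
    s.map (Equiv.addRight (pt g)).toEmbedding ∈ complex.faces
  chart : Plane ≃ₜ Plane
  chart_equivariant : ∀ (g : Deck) (x : Plane), chart (x + pt g) = chart x + pt g

/-- `p` and `q` are the endpoints of an edge of the lifted triangulation. -/
def OneVertexTriangulation.IsEdge (T : OneVertexTriangulation) (p q : Deck) : Prop :=
  ∃ e ∈ T.complex.faces, (e : Set Plane) = {pt p, pt q}

/-- `t` is the vertex set of a (closed) triangle of the lifted triangulation. -/
def OneVertexTriangulation.IsTriangle (T : OneVertexTriangulation) (t : Finset Plane) : Prop :=
  t ∈ T.complex.faces ∧ t.card = 3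

/-! ### From an order to an action on the line -/

section Action

variable [LinearOrder Deck]

/-- The minimal embedding of the totally ordered set `{s 0, s 1, …}` into `ℝ`, as a function of
the index. The first term has value `0`; a new maximum (minimum) is put at distance `1` above
(below) all previous values; every other term is put at the midpoint between the values of its
closest predecessors in the list from below and from above. -/
noncomputable def minimalValue (s : ℕ → Deck) (n : ℕ) : ℝ :=
  let below : Set ℝ := {x | ∃ p : Fin n, s p < s n ∧ x = minimalValue s p}
  let above : Set ℝ := {x | ∃ p : Fin n, s n < s p ∧ x = minimalValue s p}
  open Classical in
  if n = 0 then 0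
  else if above = ∅ then sSup below + 1
  else if below = ∅ then sInf above - 1
  else (sSup below + sInf above) / 2
termination_by n
decreasing_by all_goals exact p.2

/-- The minimal embedding `i₀ : ℤ² → ℝ` determined by an enumeration `s` of `ℤ²`. -/
noncomputable def minimalEmbedding (s : ℕ ≃ Deck) (g : Deck) : ℝ :=
  minimalValue s (s.symm g)

/-- The action `ρ_i` on `ℝ` obtained from `i : ℤ² → ℝ`: on the image of `i` it is
`i h ↦ i (g + h)`, and it is extended continuously to the closure of the image, and linearly to
the complementary intervals. Here `a` and `b` are the points of the closure of the image next to
`t` from below and from above (equal to `t` if `t` lies in the closure), and `a'` and `b'` are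
the points to which `g` sends them. -/
noncomputable def extendedAction (i : Deck → ℝ) (g : Deck) (t : ℝ) : ℝ :=
  let a := sSup {x | ∃ h, i h ≤ t ∧ x = i h}
  let b := sInf {x | ∃ h, t ≤ i h ∧ x = i h}
  let a' := sSup {x | ∃ h, i h ≤ t ∧ x = i (g + h)}
  let b' := sInf {x | ∃ h, t ≤ i h ∧ x = i (g + h)}
  open Classical in
  if a = b then a' else a' + (t - a) / (b - a) * (b' - a')

/-- `ρ` is an allowed action of `ℤ²` on the line inducing the given order: an action by
homeomorphisms for which `g ↦ ρ(g)(0)` is injective and order preserving. -/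
structure IsAllowedAction (ρ : Deck → ℝ → ℝ) : Prop where
  map_zero : ∀ t, ρ 0 t = t
  map_add : ∀ g h t, ρ (g + h) t = ρ g (ρ h t)
  continuous : ∀ g, Continuous (ρ g)
  orbit_lt_iff : ∀ g h, ρ g 0 < ρ h 0 ↔ g < h

/-! ### The singular foliation of an action -/

/-- The points of the 1-skeleton at which the defining function `F` has the value `c`.
On an edge from `p` to `q` with `p < q`, `F` is defined by `F x = ρ(q) (F (x - q))`, where on the
translated edge, which ends at the base vertex `0`, `F` is linear from `F (p - q) = ρ(p - q)(0)`
to `F 0 = 0`. In particular, `F` has the value `ρ(g)(0)` at the vertex `g`. -/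
def skeletonLevel (T : OneVertexTriangulation) (ρ : Deck → ℝ → ℝ) (c : ℝ) : Set Plane :=
  {x | ∃ p q : Deck, p < q ∧ T.IsEdge p q ∧ ∃ u ∈ Set.Icc (0 : ℝ) 1,
    x = AffineMap.lineMap (pt p) (pt q) u ∧ c = ρ q ((1 - u) * ρ (p - q) 0)}

/-- The defining function `F : ℝ² → ℝ` (in the straight coordinates of the triangulation). It is
extended from the 1-skeleton to each triangle in such a way that its level sets in the triangle
are the polytopes whose vertices are the points of that level on the boundary of the triangle:
`F x` is the value `c` for which `x` lies in the convex hull of the points of level `c` on the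
boundary of a triangle containing `x`. -/
noncomputable def definingFunction (T : OneVertexTriangulation) (ρ : Deck → ℝ → ℝ)
    (x : Plane) : ℝ :=
  Classical.epsilon fun c : ℝ => ∃ t : Finset Plane, T.IsTriangle t ∧
    x ∈ convexHull ℝ (skeletonLevel T ρ c ∩ convexHull ℝ (t : Set Plane))

/-- The leaves on the torus of the singular foliation `F(T, ρ)`: the images under the covering map
of the connected components of the level sets of the defining function. -/
def IsLeaf (T : OneVertexTriangulation) (ρ : Deck → ℝ → ℝ) (L : Set Torus) : Prop :=
  ∃ x : Plane, L = (fun y => cover (T.chart y)) ''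
    connectedComponentIn {y | definingFunction T ρ y = definingFunction T ρ x} x

/-- The foliation `F(T, ρ)` has a closed leaf, i.e. a leaf which is a simple closed curve. -/
def HasClosedLeaf (T : OneVertexTriangulation) (ρ : Deck → ℝ → ℝ) : Prop :=
  ∃ L : Set Torus, IsLeaf T ρ L ∧ Nonempty (L ≃ₜ Circle)

end Action

end FLOiation

/-!
A one-vertex triangulation of the torus has, in its straight coordinates, the translates of two
triangles `0, a, a + b` and `0, b, a + b` with `0 < a, b` as its triangles. In each of them the
level sets of the defining function `F` are segments that cut off a corner, and `F` is strictly
increasing in the direction of the long edge `a + b`. Hence every level set is the graph of a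
continuous function over the line transverse to `a + b`, and the leaf of level `c` is the image of
this graph, whose periods are the components along `a` of the elements of the stabilizer of `c`.
A nonzero stabilizer element has nonzero component along `a`, as `F` is injective along `a + b`;
so the leaf is a circle if the stabilizer is nontrivial, and an injective image of the line, which
is not a circle, if it is trivial.

Every value of `F` lies between two points of the orbit of `0`. If a nonzero element fixes such a
value, its multiples are bounded and the order is not Archimedean; conversely, if the multiples of
a positive element are bounded, the orbit of `0` under them converges to a fixed point.

The gaps in the closure of the image of the minimal embedding are exactly those between adjacent
elements of the group, because at every other cut the midpoints halve the distance again and again.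
Translations preserve adjacency, so the extended action is an allowed one.
-/

namespace FLOiation

section Sequences

variable {α : Type*} [LinearOrder α] {s : ℕ → α}

lemma exists_lt_forall_lt_of_surjective [NoMaxOrder α] (hs : Function.Surjective s) (m : ℕ) :
    ∃ n, m < n ∧ ∀ p < n, s p < s n := by
  classical
  have hex : ∃ n, ∀ p ≤ m, s p < s n := by
    obtain ⟨k, -, hk⟩ := Set.exists_max_image (Set.Iic m) s (Set.finite_Iic m) Set.nonempty_Iic
    obtain ⟨g, hg⟩ := exists_gt (s k)
    obtain ⟨n, rfl⟩ := hs g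
    exact ⟨n, fun p hp => (hk p hp).trans_lt hg⟩
  refine ⟨Nat.find hex, ?_, fun p hp => ?_⟩
  · by_contra! h
    exact (Nat.find_spec hex _ h).false
  · obtain ⟨q, hq, hpq⟩ : ∃ q ≤ m, s p ≤ s q := by simpa using Nat.find_min hex hp
    exact hpq.trans_lt (Nat.find_spec hex q hq)

lemma exists_adjacent_values {n : ℕ} (hne : ∀ r < n, s r ≠ s n) (hbelow : ∃ r < n, s r < s n)
    (habove : ∃ r < n, s n < s r) :
    ∃ p < n, ∃ q < n, s p < s n ∧ s n < s q ∧ ∀ r < n, s r ≤ s p ∨ s q ≤ s r := by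
  obtain ⟨p, ⟨hpn, hp⟩, hpmax⟩ := Set.exists_max_image {r | r < n ∧ s r < s n} s
    ((Set.finite_lt_nat n).subset fun r hr => hr.1) hbelow
  obtain ⟨q, ⟨hqn, hq⟩, hqmin⟩ := Set.exists_min_image {r | r < n ∧ s n < s r} s
    ((Set.finite_lt_nat n).subset fun r hr => hr.1) habove
  exact ⟨p, hpn, q, hqn, hp, hq, fun r hr =>
    (lt_or_gt_of_ne (hne r hr)).imp (fun h => hpmax r ⟨hr, h⟩) fun h => hqmin r ⟨hr, h⟩⟩

end Sequences

/-! ### The minimal embedding -/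

section MinimalEmbedding

open Set

variable [LinearOrder Deck]

lemma finite_setOf_minimalValue (s : ℕ → Deck) (n : ℕ) (P : Fin n → Prop) :
    {x | ∃ p : Fin n, P p ∧ x = minimalValue s p}.Finite :=
  (finite_range fun p : Fin n => minimalValue s p).subset fun _ ⟨p, _, hx⟩ => ⟨p, hx.symm⟩

lemma minimalValue_zero (s : ℕ → Deck) : minimalValue s 0 = 0 := by
  simp [minimalValue]

lemma minimalValue_add_one_le {s : ℕ → Deck} {n p : ℕ} (h : ∀ r < n, s r < s n) (hp : p < n) :
    minimalValue s p + 1 ≤ minimalValue s n := by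
  have above_empty : {x : ℝ | ∃ r : Fin n, s n < s r ∧ x = minimalValue s r} = ∅ :=
    eq_empty_of_forall_notMem fun _ ⟨r, hr, _⟩ => hr.not_gt (h r r.2)
  rw [minimalValue.eq_1 s n]
  simp only [Nat.ne_zero_of_lt hp, if_false, above_empty, if_true]
  gcongr
  exact le_csSup (finite_setOf_minimalValue s n _).bddAbove ⟨⟨p, hp⟩, h p hp, rfl⟩

lemma minimalValue_le_sub_one {s : ℕ → Deck} {n p : ℕ} (h : ∀ r < n, s n < s r) (hp : p < n) :
    minimalValue s n ≤ minimalValue s p - 1 := by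
  have above_nonempty : {x : ℝ | ∃ r : Fin n, s n < s r ∧ x = minimalValue s r} ≠ ∅ :=
    Nonempty.ne_empty ⟨_, ⟨p, hp⟩, h p hp, rfl⟩
  have below_empty : {x : ℝ | ∃ r : Fin n, s r < s n ∧ x = minimalValue s r} = ∅ :=
    eq_empty_of_forall_notMem fun _ ⟨r, hr, _⟩ => hr.not_gt (h r r.2)
  rw [minimalValue.eq_1 s n]
  simp only [Nat.ne_zero_of_lt hp, if_false, above_nonempty, below_empty, if_true]
  gcongr
  exact csInf_le (finite_setOf_minimalValue s n _).bddBelow ⟨⟨p, hp⟩, h p hp, rfl⟩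

lemma minimalValue_eq_midpoint {s : ℕ → Deck} {n p q : ℕ}
    (hmono : ∀ i < n, ∀ j < n, s i ≤ s j → minimalValue s i ≤ minimalValue s j)
    (hp : p < n) (hq : q < n) (hpn : s p < s n) (hnq : s n < s q)
    (hadj : ∀ r < n, s r ≤ s p ∨ s q ≤ s r) :
    minimalValue s n = (minimalValue s p + minimalValue s q) / 2 := by
  have greatest_below :
      IsGreatest {x | ∃ r : Fin n, s r < s n ∧ x = minimalValue s r} (minimalValue s p) := by
    refine ⟨⟨⟨p, hp⟩, hpn, rfl⟩, ?_⟩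
    rintro _ ⟨r, hr, rfl⟩
    exact hmono r r.2 p hp ((hadj r r.2).resolve_right (hr.trans hnq).not_ge)
  have least_above :
      IsLeast {x | ∃ r : Fin n, s n < s r ∧ x = minimalValue s r} (minimalValue s q) := by
    refine ⟨⟨⟨q, hq⟩, hnq, rfl⟩, ?_⟩
    rintro _ ⟨r, hr, rfl⟩
    exact hmono q hq r r.2 ((hadj r r.2).resolve_left (hpn.trans hr).not_ge)
  rw [minimalValue.eq_1 s n]
  simp only [Nat.ne_zero_of_lt hp, if_false, greatest_below.nonempty.ne_empty,
    least_above.nonempty.ne_empty, greatest_below.csSup_eq, least_above.csInf_eq]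

lemma minimalValue_lt_and_lt_of_lt {s : ℕ → Deck} {n p : ℕ} (hs : Function.Injective s)
    (ih : ∀ i < n, ∀ j < n, s i < s j → minimalValue s i < minimalValue s j) (hp : p < n) :
    (s p < s n → minimalValue s p < minimalValue s n) ∧
      (s n < s p → minimalValue s n < minimalValue s p) := by
  have hmono : ∀ i < n, ∀ j < n, s i ≤ s j → minimalValue s i ≤ minimalValue s j :=
    fun i hi j hj hij => hij.eq_or_lt.elim (fun h => by rw [hs h]) fun h => (ih i hi j hj h).le
  have hne : ∀ r < n, s r ≠ s n := fun r hr => hs.ne hr.ne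
  by_cases habove : ∃ r < n, s n < s r
  · by_cases hbelow : ∃ r < n, s r < s n
    · obtain ⟨a, ha, b, hb, han, hnb, hadj⟩ := exists_adjacent_values hne hbelow habove
      have hmid := minimalValue_eq_midpoint hmono ha hb han hnb hadj
      have hab := ih a ha b hb (han.trans hnb)
      constructor <;> intro h
      · have := hmono p hp a ha ((hadj p hp).resolve_right (h.trans hnb).not_ge)
        linarith
      · have := hmono b hb p hp ((hadj p hp).resolve_left (han.trans h).not_ge)
        linarith
    · push Not at hbelow
      have hmin : ∀ r < n, s n < s r := fun r hr => (hbelow r hr).lt_of_ne (hne r hr).symm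
      have := minimalValue_le_sub_one hmin hp
      exact ⟨fun h => absurd (hmin p hp) h.not_gt, fun _ => by linarith⟩
  · push Not at habove
    have hmax : ∀ r < n, s r < s n := fun r hr => (habove r hr).lt_of_ne (hne r hr)
    have := minimalValue_add_one_le hmax hp
    exact ⟨fun _ => by linarith, fun h => absurd (hmax p hp) h.not_gt⟩

lemma minimalValue_lt {s : ℕ → Deck} (hs : Function.Injective s) (n : ℕ) :
    ∀ p < n, ∀ q < n, s p < s q → minimalValue s p < minimalValue s q := by
  induction n with
  | zero => exact fun p hp => absurd hp p.not_lt_zero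
  | succ n ih =>
    intro p hp q hq hpq
    rcases Nat.lt_succ_iff_lt_or_eq.1 hp with hp | rfl <;>
      rcases Nat.lt_succ_iff_lt_or_eq.1 hq with hq | rfl
    · exact ih p hp q hq hpq
    · exact (minimalValue_lt_and_lt_of_lt hs ih hp).1 hpq
    · exact (minimalValue_lt_and_lt_of_lt hs ih hq).2 hpq
    · exact absurd hpq (lt_irrefl _)

variable (s : ℕ ≃ Deck)

lemma minimalEmbedding_apply (n : ℕ) : minimalEmbedding s (s n) = minimalValue s n := by
  rw [minimalEmbedding, s.symm_apply_apply]

lemma minimalEmbedding_apply_zero : minimalEmbedding s (s 0) = 0 := by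
  rw [minimalEmbedding_apply, minimalValue_zero]

lemma strictMono_minimalEmbedding : StrictMono (minimalEmbedding s) := fun g h hgh =>
  minimalValue_lt s.injective (max (s.symm g) (s.symm h) + 1) _ (by lia) _ (by lia)
    (by simpa only [s.apply_symm_apply] using hgh)

lemma exists_minimalEmbedding_add_one_le [NoMaxOrder Deck] (g : Deck) :
    ∃ h, minimalEmbedding s g + 1 ≤ minimalEmbedding s h := by
  obtain ⟨m, rfl⟩ := s.surjective g
  obtain ⟨n, hn, hlt⟩ := exists_lt_forall_lt_of_surjective s.surjective m
  exact ⟨s n, by simpa only [minimalEmbedding_apply] using minimalValue_add_one_le hlt hn⟩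

lemma exists_minimalEmbedding_le_sub_one [NoMinOrder Deck] (g : Deck) :
    ∃ h, minimalEmbedding s h ≤ minimalEmbedding s g - 1 := by
  obtain ⟨m, rfl⟩ := s.surjective g
  obtain ⟨n, hn, hlt⟩ : ∃ n, m < n ∧ ∀ p < n, s n < s p :=
    exists_lt_forall_lt_of_surjective (OrderDual.toDual.surjective.comp s.surjective) m
  exact ⟨s n, by simpa only [minimalEmbedding_apply] using minimalValue_le_sub_one hlt hn⟩

lemma not_bddAbove_range_minimalEmbedding [NoMaxOrder Deck] :
    ¬ BddAbove (range (minimalEmbedding s)) := by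
  intro hbdd
  obtain ⟨_, ⟨g, rfl⟩, hg⟩ := exists_lt_of_lt_csSup (range_nonempty (minimalEmbedding s))
    (sub_one_lt _)
  obtain ⟨h, hh⟩ := exists_minimalEmbedding_add_one_le s g
  linarith [le_csSup hbdd (mem_range_self h)]

lemma not_bddBelow_range_minimalEmbedding [NoMinOrder Deck] :
    ¬ BddBelow (range (minimalEmbedding s)) := by
  intro hbdd
  obtain ⟨_, ⟨g, rfl⟩, hg⟩ := exists_lt_of_csInf_lt (range_nonempty (minimalEmbedding s))
    (lt_add_one _)
  obtain ⟨h, hh⟩ := exists_minimalEmbedding_le_sub_one s g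
  linarith [csInf_le hbdd (mem_range_self h)]

lemma exists_minimalEmbedding_eq_midpoint {N p q : ℕ} (hp : p < N) (hq : q < N)
    (hadj : ∀ r < N, s r ≤ s p ∨ s q ≤ s r) (hex : ∃ g, s p < g ∧ g < s q) :
    ∃ g, s p < g ∧ g < s q ∧
      minimalEmbedding s g = (minimalEmbedding s (s p) + minimalEmbedding s (s q)) / 2 := by
  classical
  have hex' : ∃ n, s p < s n ∧ s n < s q := s.surjective.exists.1 hex
  obtain ⟨hpn, hnq⟩ := Nat.find_spec hex'
  have hN : N ≤ Nat.find hex' := by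
    by_contra! h
    rcases hadj _ h with h | h
    exacts [hpn.not_ge h, hnq.not_ge h]
  have hadj' : ∀ r < Nat.find hex', s r ≤ s p ∨ s q ≤ s r := fun r hr => by
    simpa only [not_and_or, not_lt] using Nat.find_min hex' hr
  refine ⟨_, hpn, hnq, ?_⟩
  simp only [minimalEmbedding_apply]
  refine minimalValue_eq_midpoint (fun i _ j _ hij => ?_) (by lia) (by lia) hpn hnq hadj'
  simpa only [minimalEmbedding_apply] using (strictMono_minimalEmbedding s).monotone hij

lemma exists_minimalEmbedding_sub_le_half {A : Set Deck}
    (hA : ∀ a ∈ A, ∀ b ∉ A, ∃ g, a < g ∧ g < b) {a b : Deck} (ha : a ∈ A) (hb : b ∉ A) :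
    ∃ a' ∈ A, ∃ b' ∉ A, minimalEmbedding s b' - minimalEmbedding s a' ≤
      (minimalEmbedding s b - minimalEmbedding s a) / 2 := by
  set N := max (s.symm a) (s.symm b) + 1
  obtain ⟨p, ⟨hpN, hpA⟩, hpmax⟩ := exists_max_image {r | r < N ∧ s r ∈ A} s
    ((finite_lt_nat N).subset fun r hr => hr.1) ⟨s.symm a, by lia, by simpa using ha⟩
  obtain ⟨q, ⟨hqN, hqA⟩, hqmin⟩ := exists_min_image {r | r < N ∧ s r ∉ A} s
    ((finite_lt_nat N).subset fun r hr => hr.1) ⟨s.symm b, by lia, by simpa using hb⟩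
  have hap : a ≤ s p := by simpa using hpmax (s.symm a) ⟨by lia, by simpa using ha⟩
  have hqb : s q ≤ b := by simpa using hqmin (s.symm b) ⟨by lia, by simpa using hb⟩
  have hap' := (strictMono_minimalEmbedding s).monotone hap
  have hqb' := (strictMono_minimalEmbedding s).monotone hqb
  have hadj : ∀ r < N, s r ≤ s p ∨ s q ≤ s r := fun r hr =>
    (em (s r ∈ A)).imp (fun h => hpmax r ⟨hr, h⟩) fun h => hqmin r ⟨hr, h⟩
  obtain ⟨g, -, -, hg⟩ := exists_minimalEmbedding_eq_midpoint s hpN hqN hadj (hA _ hpA _ hqA)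
  by_cases hgA : g ∈ A
  · exact ⟨g, hgA, s q, hqA, by linarith⟩
  · exact ⟨s p, hpA, g, hgA, by linarith⟩

lemma exists_minimalEmbedding_sub_lt {A : Set Deck} (hne : A.Nonempty) (hne' : Aᶜ.Nonempty)
    (hA : ∀ a ∈ A, ∀ b ∉ A, ∃ g, a < g ∧ g < b) {ε : ℝ} (hε : 0 < ε) :
    ∃ a ∈ A, ∃ b ∉ A, minimalEmbedding s b - minimalEmbedding s a < ε := by
  obtain ⟨a₀, ha₀⟩ := hne
  obtain ⟨b₀, hb₀⟩ := hne'
  set δ := minimalEmbedding s b₀ - minimalEmbedding s a₀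
  have hhalve : ∀ n : ℕ, ∃ a ∈ A, ∃ b ∉ A,
      minimalEmbedding s b - minimalEmbedding s a ≤ δ / 2 ^ n := fun n => by
    induction n with
    | zero => exact ⟨a₀, ha₀, b₀, hb₀, by simp [δ]⟩
    | succ n ih =>
      obtain ⟨a, ha, b, hb, hab⟩ := ih
      obtain ⟨a', ha', b', hb', hab'⟩ := exists_minimalEmbedding_sub_le_half s hA ha hb
      exact ⟨a', ha', b', hb', hab'.trans (by rw [pow_succ, ← div_div]; linarith)⟩
  obtain ⟨n, hn⟩ := pow_unbounded_of_one_lt (δ / ε) one_lt_two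
  obtain ⟨a, ha, b, hb, hab⟩ := hhalve n
  exact ⟨a, ha, b, hb, hab.trans_lt ((div_lt_comm₀ hε (by positivity)).1 hn)⟩

end MinimalEmbedding

/-! ### The action of the minimal embedding -/

section ExtendedAction

open Set

lemma extendedAction_eq (i : Deck → ℝ) (g : Deck) (t : ℝ) :
    extendedAction i g t =
      sSup {x | ∃ h, i h ≤ t ∧ x = i (g + h)} +
        (t - sSup {x | ∃ h, i h ≤ t ∧ x = i h}) /
            (sInf {x | ∃ h, t ≤ i h ∧ x = i h} - sSup {x | ∃ h, i h ≤ t ∧ x = i h}) *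
          (sInf {x | ∃ h, t ≤ i h ∧ x = i (g + h)} - sSup {x | ∃ h, i h ≤ t ∧ x = i (g + h)}) := by
  dsimp only [extendedAction]
  split_ifs with h
  · rw [h, sub_self, div_zero, zero_mul, add_zero]
  · rfl

variable [LinearOrder Deck]

/-- An order embedding of the group in the line whose translation action extends to an action of
the group by homeomorphisms: its image is unbounded in both directions, and the only gaps in the
closure of its image are those between adjacent elements of the group. -/
structure IsTightEmbedding (i : Deck → ℝ) : Prop where
  strictMono : StrictMono i
  not_bddAbove : ¬ BddAbove (range i)
  not_bddBelow : ¬ BddBelow (range i)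
  exists_sub_lt : ∀ A : Set Deck, A.Nonempty → Aᶜ.Nonempty →
    (∀ a ∈ A, ∀ b ∉ A, ∃ g, a < g ∧ g < b) → ∀ ε > 0, ∃ a ∈ A, ∃ b ∉ A, i b - i a < ε

instance : Nontrivial Deck := inferInstanceAs (Nontrivial (ℤ × ℤ))

namespace IsTightEmbedding

variable {i : Deck → ℝ} (hi : IsTightEmbedding i)
include hi

lemma exists_lt (t : ℝ) : ∃ g, i g < t := by
  simpa using not_bddBelow_iff.1 hi.not_bddBelow t

lemma exists_gt (t : ℝ) : ∃ g, t < i g := by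
  simpa using not_bddAbove_iff.1 hi.not_bddAbove t

variable [IsOrderedAddMonoid Deck]

lemma apply_add_le_apply_add {g h h' : Deck} {t : ℝ} (hh : i h ≤ t) (hh' : t ≤ i h') :
    i (g + h) ≤ i (g + h') :=
  hi.strictMono.monotone (add_le_add_right (hi.strictMono.le_iff_le.1 (hh.trans hh')) g)

lemma extendedAction_mem_Icc (g : Deck) (t : ℝ) :
    extendedAction i g t ∈ Icc (sSup {x | ∃ h, i h ≤ t ∧ x = i (g + h)})
      (sInf {x | ∃ h, t ≤ i h ∧ x = i (g + h)}) := by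
  obtain ⟨k₀, hk₀⟩ := hi.exists_lt t
  obtain ⟨k₁, hk₁⟩ := hi.exists_gt t
  have sSup_le : sSup {x | ∃ h, i h ≤ t ∧ x = i h} ≤ t :=
    csSup_le ⟨_, k₀, hk₀.le, rfl⟩ (by rintro _ ⟨h, hh, rfl⟩; exact hh)
  have le_sInf : t ≤ sInf {x | ∃ h, t ≤ i h ∧ x = i h} :=
    le_csInf ⟨_, k₁, hk₁.le, rfl⟩ (by rintro _ ⟨h, hh, rfl⟩; exact hh)
  have sSup_le_sInf : sSup {x | ∃ h, i h ≤ t ∧ x = i (g + h)} ≤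
      sInf {x | ∃ h, t ≤ i h ∧ x = i (g + h)} := by
    refine csSup_le ⟨_, k₀, hk₀.le, rfl⟩ ?_
    rintro _ ⟨h, hh, rfl⟩
    refine le_csInf ⟨_, k₁, hk₁.le, rfl⟩ ?_
    rintro _ ⟨h', hh', rfl⟩
    exact hi.apply_add_le_apply_add hh hh'
  rw [extendedAction_eq]
  set a := sSup {x | ∃ h, i h ≤ t ∧ x = i h}
  set b := sInf {x | ∃ h, t ≤ i h ∧ x = i h}
  have ratio_nonneg : 0 ≤ (t - a) / (b - a) := div_nonneg (by linarith) (by linarith)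
  have ratio_le_one : (t - a) / (b - a) ≤ 1 := div_le_one_of_le₀ (by linarith) (by linarith)
  constructor <;> nlinarith

lemma apply_add_le_extendedAction {g h : Deck} {t : ℝ} (hh : i h ≤ t) :
    i (g + h) ≤ extendedAction i g t := by
  obtain ⟨k, hk⟩ := hi.exists_gt t
  refine (hi.extendedAction_mem_Icc g t).1.trans' (le_csSup ⟨i (g + k), ?_⟩ ⟨h, hh, rfl⟩)
  rintro _ ⟨h', hh', rfl⟩
  exact hi.apply_add_le_apply_add hh' hk.le

lemma extendedAction_le_apply_add {g h : Deck} {t : ℝ} (hh : t ≤ i h) :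
    extendedAction i g t ≤ i (g + h) := by
  obtain ⟨k, hk⟩ := hi.exists_lt t
  refine (hi.extendedAction_mem_Icc g t).2.trans (csInf_le ⟨i (g + k), ?_⟩ ⟨h, hh, rfl⟩)
  rintro _ ⟨h', hh', rfl⟩
  exact hi.apply_add_le_apply_add hk.le hh'

lemma extendedAction_apply (g h : Deck) : extendedAction i g (i h) = i (g + h) :=
  le_antisymm (hi.extendedAction_le_apply_add le_rfl) (hi.apply_add_le_extendedAction le_rfl)

lemma extendedAction_of_mem_gap (g : Deck) {h₀ h₁ : Deck} (hadj : ∀ k, k ≤ h₀ ∨ h₁ ≤ k) {t : ℝ}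
    (ht : t ∈ Ioo (i h₀) (i h₁)) :
    extendedAction i g t =
      i (g + h₀) + (t - i h₀) / (i h₁ - i h₀) * (i (g + h₁) - i (g + h₀)) := by
  have hmono := hi.strictMono.monotone
  have le_left : ∀ k, i k ≤ t → k ≤ h₀ := fun k hk =>
    (hadj k).resolve_right fun h => (hk.trans_lt ht.2).not_ge (hmono h)
  have right_le : ∀ k, t ≤ i k → h₁ ≤ k := fun k hk =>
    (hadj k).resolve_left fun h => (ht.1.trans_le hk).not_ge (hmono h)
  have greatest (g) : IsGreatest {x | ∃ h, i h ≤ t ∧ x = i (g + h)} (i (g + h₀)) :=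
    ⟨⟨h₀, ht.1.le, rfl⟩, by
      rintro _ ⟨h, hh, rfl⟩; exact hmono (add_le_add_right (le_left h hh) g)⟩
  have least (g) : IsLeast {x | ∃ h, t ≤ i h ∧ x = i (g + h)} (i (g + h₁)) :=
    ⟨⟨h₁, ht.2.le, rfl⟩, by
      rintro _ ⟨h, hh, rfl⟩; exact hmono (add_le_add_right (right_le h hh) g)⟩
  have sSup_eq := (greatest 0).csSup_eq
  have sInf_eq := (least 0).csInf_eq
  simp only [zero_add] at sSup_eq sInf_eq
  rw [extendedAction_eq, sSup_eq, sInf_eq, (greatest g).csSup_eq, (least g).csInf_eq]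

lemma exists_gap_or_exists_sub_lt (t : ℝ) :
    (∃ h₀ h₁, (∀ k, k ≤ h₀ ∨ h₁ ≤ k) ∧ t ∈ Ioo (i h₀) (i h₁)) ∨
      ∀ g, ∀ ε > 0, ∃ h h', i h ≤ t ∧ t ≤ i h' ∧ i (g + h') - i (g + h) < ε := by
  by_cases hgap : ∃ a, i a ≤ t ∧ ∃ b, t < i b ∧ ∀ g, g ≤ a ∨ b ≤ g
  · obtain ⟨a, ha, b, hb, hab⟩ := hgap
    rcases ha.eq_or_lt with rfl | ha
    · exact Or.inr fun g ε hε => ⟨a, a, le_rfl, le_rfl, by rwa [sub_self]⟩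
    · exact Or.inl ⟨a, b, hab, ha, hb⟩
  · push Not at hgap
    refine Or.inr fun g ε hε => ?_
    obtain ⟨k₀, hk₀⟩ := hi.exists_lt t
    obtain ⟨k₁, hk₁⟩ := hi.exists_gt t
    obtain ⟨a, ha, b, hb, hab⟩ := hi.exists_sub_lt {k | i (-g + k) ≤ t}
      ⟨g + k₀, by simpa using hk₀.le⟩ ⟨g + k₁, by simpa using hk₁⟩
      (fun a ha b hb => by
        obtain ⟨k, hak, hkb⟩ := hgap _ ha _ (not_le.1 hb)
        exact ⟨g + k, neg_add_lt_iff_lt_add.1 hak, lt_neg_add_iff_add_lt.1 hkb⟩) ε hε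
    exact ⟨-g + a, -g + b, ha, (not_le.1 hb).le, by simpa using hab⟩

lemma extendedAction_eq_of_forall_exists_sub_lt {g : Deck} {t x : ℝ}
    (ht : ∀ ε > 0, ∃ h h', i h ≤ t ∧ t ≤ i h' ∧ i (g + h') - i (g + h) < ε)
    (hle : ∀ h, i h ≤ t → i (g + h) ≤ x) (hge : ∀ h, t ≤ i h → x ≤ i (g + h)) :
    extendedAction i g t = x := by
  refine eq_of_abs_sub_nonpos (le_of_forall_pos_le_add fun ε hε => ?_)
  obtain ⟨h, h', hh, hh', hlt⟩ := ht ε hε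
  have := hi.apply_add_le_extendedAction (g := g) hh
  have := hi.extendedAction_le_apply_add (g := g) hh'
  have := hle h hh
  have := hge h' hh'
  rw [abs_le]
  constructor <;> linarith

lemma monotone_extendedAction (g : Deck) : Monotone (extendedAction i g) := by
  intro t t' htt
  by_cases hex : ∃ h, t ≤ i h ∧ i h ≤ t'
  · obtain ⟨h, hth, hht⟩ := hex
    exact (hi.extendedAction_le_apply_add hth).trans (hi.apply_add_le_extendedAction hht)
  push Not at hex
  rcases hi.exists_gap_or_exists_sub_lt t with ⟨h₀, h₁, hadj, ht⟩ | hlim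
  · have hlt : i h₀ < i h₁ := ht.1.trans ht.2
    have hlt' : i (g + h₀) < i (g + h₁) :=
      hi.strictMono (add_lt_add_right (hi.strictMono.lt_iff_lt.1 hlt) g)
    rw [hi.extendedAction_of_mem_gap g hadj ht,
      hi.extendedAction_of_mem_gap g hadj ⟨ht.1.trans_le htt, hex _ ht.2.le⟩]
    gcongr
  · refine le_of_forall_pos_le_add fun ε hε => ?_
    obtain ⟨h, h', hh, hh', hlt⟩ := hlim g ε hε
    have := hi.extendedAction_le_apply_add (g := g) hh'
    have := hi.apply_add_le_extendedAction (g := g) (hh.trans htt)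
    linarith

lemma extendedAction_zero (t : ℝ) : extendedAction i 0 t = t := by
  rcases hi.exists_gap_or_exists_sub_lt t with ⟨h₀, h₁, hadj, ht⟩ | hlim
  · rw [hi.extendedAction_of_mem_gap 0 hadj ht, zero_add, zero_add,
      div_mul_cancel₀ _ (sub_pos.2 (ht.1.trans ht.2)).ne', add_sub_cancel]
  · exact hi.extendedAction_eq_of_forall_exists_sub_lt (hlim 0)
      (fun h hh => by rwa [zero_add]) fun h hh => by rwa [zero_add]

lemma extendedAction_add (g h : Deck) (t : ℝ) :
    extendedAction i (g + h) t = extendedAction i g (extendedAction i h t) := by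
  rcases hi.exists_gap_or_exists_sub_lt t with ⟨h₀, h₁, hadj, ht⟩ | hlim
  · have hlt : i h₀ < i h₁ := ht.1.trans ht.2
    have hlt' : i (h + h₀) < i (h + h₁) :=
      hi.strictMono (add_lt_add_right (hi.strictMono.lt_iff_lt.1 hlt) h)
    have hadj' : ∀ k, k ≤ h + h₀ ∨ h + h₁ ≤ k := fun k =>
      (hadj (-h + k)).imp neg_add_le_iff_le_add.1 le_neg_add_iff_add_le.1
    have ratio_pos : 0 < (t - i h₀) / (i h₁ - i h₀) :=
      div_pos (sub_pos.2 ht.1) (sub_pos.2 hlt)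
    have ratio_lt_one : (t - i h₀) / (i h₁ - i h₀) < 1 :=
      (div_lt_one (sub_pos.2 hlt)).2 (by linarith [ht.2])
    rw [hi.extendedAction_of_mem_gap (g + h) hadj ht, hi.extendedAction_of_mem_gap h hadj ht,
      hi.extendedAction_of_mem_gap g hadj' ⟨by nlinarith, by nlinarith⟩, add_sub_cancel_left,
      mul_div_cancel_right₀ _ (sub_pos.2 hlt').ne', add_assoc, add_assoc]
  · refine hi.extendedAction_eq_of_forall_exists_sub_lt (hlim (g + h)) (fun k hk => ?_)
      fun k hk => ?_
    · rw [add_assoc]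
      exact hi.apply_add_le_extendedAction (hi.apply_add_le_extendedAction hk)
    · rw [add_assoc]
      exact hi.extendedAction_le_apply_add (hi.extendedAction_le_apply_add hk)

theorem isAllowedAction {h₀ : Deck} (h0 : i h₀ = 0) : IsAllowedAction (extendedAction i) where
  map_zero := hi.extendedAction_zero
  map_add := hi.extendedAction_add
  continuous g := (hi.monotone_extendedAction g).continuous_of_surjective fun t =>
    ⟨extendedAction i (-g) t, by
      rw [← hi.extendedAction_add, add_neg_cancel, hi.extendedAction_zero]⟩
  -- Commutativity makes `g ↦ g + h₀` order preserving, whichever element `h₀` sits at the origin.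
  orbit_lt_iff g h := by
    rw [← h0, hi.extendedAction_apply, hi.extendedAction_apply, hi.strictMono.lt_iff_lt,
      add_lt_add_iff_right]

end IsTightEmbedding

variable [IsOrderedAddMonoid Deck] (s : ℕ ≃ Deck)

theorem isTightEmbedding_minimalEmbedding : IsTightEmbedding (minimalEmbedding s) where
  strictMono := strictMono_minimalEmbedding s
  not_bddAbove := not_bddAbove_range_minimalEmbedding s
  not_bddBelow := not_bddBelow_range_minimalEmbedding s
  exists_sub_lt _ hne hne' hA _ hε := exists_minimalEmbedding_sub_lt s hne hne' hA hε

theorem isAllowedAction_extendedAction_minimalEmbedding :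
    IsAllowedAction (extendedAction (minimalEmbedding s)) :=
  (isTightEmbedding_minimalEmbedding s).isAllowedAction (minimalEmbedding_apply_zero s)

end ExtendedAction

/-! ### The defining function on edges -/

section Edges

open Set

/-- The orbit map `g ↦ g · 0` as a homomorphism from the deck group to the vector space that it
acts on by translations. -/
def ptHom : Deck →+ Plane where
  toFun := pt
  map_zero' := Prod.ext Int.cast_zero Int.cast_zero
  map_add' g h := Prod.ext (Int.cast_add g.1 h.1) (Int.cast_add g.2 h.2)

lemma pt_zero : pt 0 = 0 := map_zero ptHom

lemma pt_add (g h : Deck) : pt (g + h) = pt g + pt h := map_add ptHom g h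

lemma pt_sub (g h : Deck) : pt (g - h) = pt g - pt h := map_sub ptHom g h

lemma pt_zsmul (n : ℤ) (g : Deck) : pt (n • g) = (n : ℝ) • pt g :=
  (map_zsmul ptHom n g).trans (Int.cast_smul_eq_zsmul ℝ n (pt g)).symm

lemma pt_injective : Function.Injective pt := fun _ _ h =>
  Prod.ext (Int.cast_injective (congrArg Prod.fst h)) (Int.cast_injective (congrArg Prod.snd h))

lemma exists_pt_eq_of_mem_face {T : OneVertexTriangulation} {s : Finset Plane}
    (hs : s ∈ T.complex.faces) {x : Plane} (hx : x ∈ s) : ∃ g, pt g = x := by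
  have hvertex : x ∈ T.complex.vertices := by
    rw [Geometry.SimplicialComplex.vertices_eq]
    exact mem_biUnion hs hx
  rwa [T.vertices_eq] at hvertex

lemma exists_map_pt_eq_of_mem_faces {T : OneVertexTriangulation} {s : Finset Plane}
    (hs : s ∈ T.complex.faces) : ∃ u : Finset Deck, u.map ⟨pt, pt_injective⟩ = s := by
  classical
  obtain ⟨u, -, hu⟩ := Finset.subset_set_image_iff.1
    (show (s : Set Plane) ⊆ pt '' univ from image_univ ▸ fun _ => exists_pt_eq_of_mem_face hs)
  exact ⟨u, by rw [Finset.map_eq_image, ← hu]; rfl⟩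

/-- The affine parameter of the point of level `c` on the edge from `p` to `q`, extended to all
`c : ℝ` by the formula that is valid for the levels between `ρ p 0` and `ρ q 0`. -/
noncomputable def edgeParam (ρ : Deck → ℝ → ℝ) (p q : Deck) (c : ℝ) : ℝ :=
  1 - ρ (-q) c / ρ (p - q) 0

/-- The point of level `c` on the line through the edge from `p` to `q`. -/
noncomputable def edgePoint (ρ : Deck → ℝ → ℝ) (p q : Deck) (c : ℝ) : Plane :=
  AffineMap.lineMap (pt p) (pt q) (edgeParam ρ p q c)

lemma edgePoint_self (ρ : Deck → ℝ → ℝ) (p : Deck) (c : ℝ) : edgePoint ρ p p c = pt p :=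
  AffineMap.lineMap_same_apply _ _

variable [LinearOrder Deck] {ρ : Deck → ℝ → ℝ}

namespace IsAllowedAction

variable (hρ : IsAllowedAction ρ)
include hρ

lemma neg_apply (g : Deck) (t : ℝ) : ρ (-g) (ρ g t) = t := by
  rw [← hρ.map_add, neg_add_cancel, hρ.map_zero]

lemma apply_neg (g : Deck) (t : ℝ) : ρ g (ρ (-g) t) = t := by
  rw [← hρ.map_add, add_neg_cancel, hρ.map_zero]

lemma orbit_le_iff (g h : Deck) : ρ g 0 ≤ ρ h 0 ↔ g ≤ h := by
  rw [← not_lt, hρ.orbit_lt_iff, not_lt]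

lemma continuous_edgeParam (p q : Deck) : Continuous (edgeParam ρ p q) :=
  continuous_const.sub ((hρ.continuous (-q)).div_const _)

lemma continuous_edgePoint (p q : Deck) : Continuous (edgePoint ρ p q) :=
  AffineMap.lineMap_continuous.comp (hρ.continuous_edgeParam p q)

lemma edgeParam_right (p q : Deck) : edgeParam ρ p q (ρ q 0) = 1 := by
  rw [edgeParam, hρ.neg_apply, zero_div, sub_zero]

lemma edgePoint_right (p q : Deck) : edgePoint ρ p q (ρ q 0) = pt q := by
  rw [edgePoint, hρ.edgeParam_right, AffineMap.lineMap_apply_one]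

variable [IsOrderedAddMonoid Deck]

lemma strictMono (g : Deck) : StrictMono (ρ g) := by
  have hinj : Function.Injective (ρ g) := Function.LeftInverse.injective (hρ.neg_apply g)
  refine ((hρ.continuous g).strictMono_of_inj hinj).resolve_right fun hanti => ?_
  obtain ⟨h, hh⟩ := exists_gt (0 : Deck)
  have hlt : ρ (g + h) 0 < ρ (g + 0) 0 := by
    rw [hρ.map_add, hρ.map_add]
    exact hanti ((hρ.orbit_lt_iff 0 h).2 hh)
  exact hh.not_gt (lt_of_add_lt_add_left ((hρ.orbit_lt_iff _ _).1 hlt))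

lemma apply_sub_neg_of_lt {p q : Deck} (h : p < q) : ρ (p - q) 0 < 0 := by
  simpa only [hρ.map_zero] using (hρ.orbit_lt_iff (p - q) 0).2 (sub_neg.2 h)

lemma strictMono_edgeParam {p q : Deck} (h : p < q) : StrictMono (edgeParam ρ p q) :=
  fun _ _ hc => sub_lt_sub_left
    ((div_lt_div_right_of_neg (hρ.apply_sub_neg_of_lt h)).2 (hρ.strictMono (-q) hc)) 1

lemma edgeParam_left {p q : Deck} (h : p < q) : edgeParam ρ p q (ρ p 0) = 0 := by
  rw [edgeParam, ← hρ.map_add, neg_add_eq_sub, div_self (hρ.apply_sub_neg_of_lt h).ne, sub_self]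

lemma edgePoint_left {p q : Deck} (h : p < q) : edgePoint ρ p q (ρ p 0) = pt p := by
  rw [edgePoint, hρ.edgeParam_left h, AffineMap.lineMap_apply_zero]

lemma edgePoint_injective {p q : Deck} (h : p < q) : Function.Injective (edgePoint ρ p q) :=
  (AffineMap.lineMap_injective ℝ (pt_injective.ne h.ne)).comp
    (hρ.strictMono_edgeParam h).injective

lemma eq_edgeParam_iff {p q : Deck} (h : p < q) (u c : ℝ) :
    u = edgeParam ρ p q c ↔ c = ρ q ((1 - u) * ρ (p - q) 0) := by
  have hne : ρ (p - q) 0 ≠ 0 := (hρ.apply_sub_neg_of_lt h).ne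
  constructor
  · rintro rfl
    rw [edgeParam, sub_sub_cancel, div_mul_cancel₀ _ hne, hρ.apply_neg]
  · rintro rfl
    rw [edgeParam, hρ.neg_apply, mul_div_cancel_right₀ _ hne, sub_sub_cancel]

lemma edgeParam_mem_Icc {p q : Deck} (h : p < q) {c : ℝ} :
    edgeParam ρ p q c ∈ Icc (0 : ℝ) 1 ↔ c ∈ Icc (ρ p 0) (ρ q 0) := by
  have hleft := (hρ.strictMono_edgeParam h).le_iff_le (a := ρ p 0) (b := c)
  have hright := (hρ.strictMono_edgeParam h).le_iff_le (a := c) (b := ρ q 0)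
  rw [hρ.edgeParam_left h] at hleft
  rw [hρ.edgeParam_right] at hright
  rw [mem_Icc, mem_Icc, hleft, hright]

lemma mem_skeletonLevel {T : OneVertexTriangulation} {c : ℝ} {x : Plane} :
    x ∈ skeletonLevel T ρ c ↔ ∃ p q : Deck, p < q ∧ T.IsEdge p q ∧
      c ∈ Icc (ρ p 0) (ρ q 0) ∧ x = edgePoint ρ p q c := by
  constructor
  · rintro ⟨p, q, hpq, he, u, hu, rfl, hc⟩
    obtain rfl := (hρ.eq_edgeParam_iff hpq u c).2 hc
    exact ⟨p, q, hpq, he, (hρ.edgeParam_mem_Icc hpq).1 hu, rfl⟩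
  · rintro ⟨p, q, hpq, he, hc, rfl⟩
    exact ⟨p, q, hpq, he, _, (hρ.edgeParam_mem_Icc hpq).2 hc, rfl,
      (hρ.eq_edgeParam_iff hpq _ c).1 rfl⟩

lemma edgePoint_mem_segment {p q : Deck} (h : p < q) {c : ℝ} (hc : c ∈ Icc (ρ p 0) (ρ q 0)) :
    edgePoint ρ p q c ∈ segment ℝ (pt p) (pt q) := by
  rw [segment_eq_image_lineMap]
  exact ⟨_, (hρ.edgeParam_mem_Icc h).2 hc, rfl⟩

-- The degenerate case `v = w` occurs when the edge through `x` meets the face in a vertex only.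
lemma exists_eq_edgePoint_of_mem_convexHull {T : OneVertexTriangulation} {c : ℝ} {x : Plane}
    (hx : x ∈ skeletonLevel T ρ c) {s : Finset Plane} (hs : s ∈ T.complex.faces)
    (hxs : x ∈ convexHull ℝ (s : Set Plane)) :
    ∃ v w : Deck, v ≤ w ∧ pt v ∈ s ∧ pt w ∈ s ∧ c ∈ Icc (ρ v 0) (ρ w 0) ∧
      x = edgePoint ρ v w c := by
  obtain ⟨p, q, hpq, ⟨e, he, hes⟩, hc, rfl⟩ := hρ.mem_skeletonLevel.1 hx
  have hmem : edgePoint ρ p q c ∈ convexHull ℝ ({pt p, pt q} ∩ s : Set Plane) := by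
    rw [← hes]
    refine T.complex.inter_subset_convexHull he hs ⟨?_, hxs⟩
    rw [hes, convexHull_pair]
    exact hρ.edgePoint_mem_segment hpq hc
  have hvertex (v : Deck) (hvs : pt v ∈ s) (hv : ({pt p, pt q} ∩ s : Set Plane) ⊆ {pt v})
      (hinj : edgePoint ρ p q (ρ v 0) = pt v) :
      ∃ v w : Deck, v ≤ w ∧ pt v ∈ s ∧ pt w ∈ s ∧ c ∈ Icc (ρ v 0) (ρ w 0) ∧
        edgePoint ρ p q c = edgePoint ρ v w c := by
    have hxv : edgePoint ρ p q c = pt v := by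
      simpa only [convexHull_singleton, mem_singleton_iff] using convexHull_mono hv hmem
    obtain rfl := hρ.edgePoint_injective hpq (hxv.trans hinj.symm)
    exact ⟨v, v, le_rfl, hvs, hvs, left_mem_Icc.2 le_rfl, hxv.trans (edgePoint_self ρ v _).symm⟩
  by_cases hp : pt p ∈ s <;> by_cases hq : pt q ∈ s
  · exact ⟨p, q, hpq.le, hp, hq, hc, rfl⟩
  · refine hvertex p hp ?_ (hρ.edgePoint_left hpq)
    rintro y ⟨rfl | rfl, hy⟩
    exacts [rfl, absurd hy hq]
  · refine hvertex q hq ?_ (hρ.edgePoint_right p q)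
    rintro y ⟨rfl | rfl, hy⟩
    exacts [absurd hy hp, rfl]
  · have hempty : ({pt p, pt q} ∩ s : Set Plane) = ∅ := by
      rw [insert_inter_of_notMem (mod_cast hp), singleton_inter_eq_empty.2 (mod_cast hq)]
    simp only [hempty, convexHull_empty, mem_empty_iff_false] at hmem

end IsAllowedAction

end Edges

/-! ### The defining function on triangles -/

section CutsCorner

open Set

/-- The point `(θ, z)` lies on the segment from `(0, L)` to `(S, 0)`. The levels of the defining
function cut off the corners of a triangle in this way, in suitable affine coordinates. -/
def CutsCorner (S L θ z : ℝ) : Prop := ∃ τ ∈ Icc (0 : ℝ) 1, θ = τ * S ∧ z = (1 - τ) * L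

lemma CutsCorner.eq {S L θ z z' : ℝ} (h : CutsCorner S L θ z) (h' : CutsCorner S L θ z')
    (h0 : S = 0 → L = 0) : z = z' := by
  obtain ⟨τ, -, rfl, rfl⟩ := h
  obtain ⟨τ', -, hθ, rfl⟩ := h'
  by_cases hS : S = 0
  · rw [h0 hS, mul_zero, mul_zero]
  · rw [mul_right_cancel₀ hS hθ]

lemma CutsCorner.lt {S L S' L' θ z z' : ℝ} (h : CutsCorner S L θ z) (h' : CutsCorner S' L' θ z')
    (hS : 0 ≤ S) (hSS' : S < S') (hL : 0 ≤ L) (hLL' : L < L') : z < z' := by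
  obtain ⟨τ, hτ, rfl, rfl⟩ := h
  obtain ⟨τ', hτ', hθ, rfl⟩ := h'
  have hle : τ' ≤ τ := by
    refine le_of_mul_le_mul_right ?_ (hS.trans_lt hSS')
    rw [← hθ]
    exact mul_le_mul_of_nonneg_left hSS'.le hτ.1
  have hlt : τ' < 1 := by
    refine lt_of_le_of_ne hτ'.2 fun h1 => hSS'.not_ge ?_
    rw [← one_mul S', ← h1, ← hθ]
    exact mul_le_of_le_one_left hS hτ.2
  calc (1 - τ) * L ≤ (1 - τ') * L := mul_le_mul_of_nonneg_right (sub_le_sub_left hle 1) hL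
    _ < (1 - τ') * L' := mul_lt_mul_of_pos_left hLL' (sub_pos.2 hlt)

lemma CutsCorner.lt_one_sub_mul {S L L' θ z : ℝ} (h : CutsCorner S L θ z)
    (hS : 0 ≤ S) (hS1 : S < 1) (hL : 0 ≤ L) (hLL' : L < L') : z < (1 - θ) * L' := by
  have hθ : θ ∈ Icc (0 : ℝ) 1 := by
    obtain ⟨τ, hτ, rfl, -⟩ := h
    exact ⟨mul_nonneg hτ.1 hS, mul_le_one₀ hτ.2 hS hS1.le⟩
  exact h.lt ⟨θ, hθ, (mul_one θ).symm, rfl⟩ hS hS1 hL hLL'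

lemma exists_cutsCorner {S L : ℝ → ℝ} {a b θ z : ℝ} (hab : a ≤ b) (hS : Continuous S)
    (hL : Continuous L) (hmono : Monotone S) (hSa : S a = 0) (hSb : S b = 1) (hLa : L a = 0)
    (hθ : θ ∈ Icc (0 : ℝ) 1) (hz : 0 ≤ z) (hzb : z ≤ (1 - θ) * L b) :
    ∃ c ∈ Icc a b, CutsCorner (S c) (L c) θ z := by
  rcases hθ.1.eq_or_lt with rfl | hθ0
  · obtain ⟨c, hc, rfl⟩ := intermediate_value_Icc hab hL.continuousOn
      (show z ∈ Icc (L a) (L b) from ⟨hLa.trans_le hz, by linarith⟩)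
    exact ⟨c, hc, 0, left_mem_Icc.2 zero_le_one, (zero_mul _).symm, by ring⟩
  · obtain ⟨c₀, hc₀, hSc₀⟩ := intermediate_value_Icc hab hS.continuousOn
      (show θ ∈ Icc (S a) (S b) by rwa [hSa, hSb])
    have hpos (c : ℝ) (hc : c ∈ Icc c₀ b) : 0 < S c :=
      hθ0.trans_le (hSc₀.symm.trans_le (hmono hc.1))
    have hcont : ContinuousOn (fun c => (1 - θ / S c) * L c) (Icc c₀ b) :=
      (continuousOn_const.sub (continuousOn_const.div hS.continuousOn
        fun c hc => (hpos c hc).ne')).mul hL.continuousOn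
    obtain ⟨c, hc, rfl⟩ := intermediate_value_Icc hc₀.2 hcont
      (show z ∈ Icc _ _ by simpa [hSc₀, hSb, hθ0.ne'] using ⟨hz, hzb⟩)
    refine ⟨c, ⟨hc₀.1.trans hc.1, hc.2⟩, θ / S c, ⟨div_nonneg hθ.1 (hpos c hc).le, ?_⟩,
      (div_mul_cancel₀ _ (hpos c hc).ne').symm, rfl⟩
    exact (div_le_one (hpos c hc)).2 (hSc₀.symm.trans_le (hmono hc.1))

end CutsCorner

section Triangles

open Set

lemma mem_convexHull_triple {E : Type*} [AddCommGroup E] [Module ℝ E] {a b c x : E} :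
    x ∈ convexHull ℝ {a, b, c} ↔
      ∃ θ z : ℝ, 0 ≤ θ ∧ 0 ≤ z ∧ θ + z ≤ 1 ∧ x = a + θ • (b - a) + z • (c - a) := by
  constructor
  · rw [convexHull_insert (insert_nonempty _ _), convexHull_pair]
    simp only [mem_convexJoin, mem_singleton_iff, exists_eq_left, segment_eq_image_lineMap]
    rintro ⟨_, ⟨u, hu, rfl⟩, v, hv, rfl⟩
    refine ⟨v * (1 - u), v * u, mul_nonneg hv.1 (sub_nonneg.2 hu.2), mul_nonneg hv.1 hu.1,
      by linarith [hv.2], ?_⟩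
    simp only [AffineMap.lineMap_apply, vsub_eq_sub, vadd_eq_add]
    module
  · rintro ⟨θ, z, hθ, hz, hs, rfl⟩
    have hmem : ∑ i, ![1 - θ - z, θ, z] i • ![a, b, c] i ∈ convexHull ℝ {a, b, c} := by
      refine (convex_convexHull ℝ _).sum_mem (fun i _ => ?_) ?_
        fun i _ => subset_convexHull ℝ _ ?_
      · fin_cases i
        exacts [by simp; linarith, hθ, hz]
      · simp only [Fin.sum_univ_three, Matrix.cons_val]
        ring
      · fin_cases i <;> simp
    convert hmem using 1
    simp only [Fin.sum_univ_three, Matrix.cons_val]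
    module

/-- The point with affine coordinates `(θ, z)` with respect to the vertex `p` and the edges from
`p` to `q` and to `r`. -/
def trianglePoint (p q r : Deck) (θ z : ℝ) : Plane :=
  pt p + θ • (pt q - pt p) + z • (pt r - pt p)

lemma edgePoint_eq_trianglePoint_left (ρ : Deck → ℝ → ℝ) (p q r : Deck) (c : ℝ) :
    edgePoint ρ p q c = trianglePoint p q r (edgeParam ρ p q c) 0 := by
  simp only [edgePoint, AffineMap.lineMap_apply, trianglePoint, vsub_eq_sub, vadd_eq_add]
  module

lemma edgePoint_eq_trianglePoint_long (ρ : Deck → ℝ → ℝ) (p q r : Deck) (c : ℝ) :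
    edgePoint ρ p r c = trianglePoint p q r 0 (edgeParam ρ p r c) := by
  simp only [edgePoint, AffineMap.lineMap_apply, trianglePoint, vsub_eq_sub, vadd_eq_add]
  module

lemma edgePoint_eq_trianglePoint_right (ρ : Deck → ℝ → ℝ) (p q r : Deck) (c : ℝ) :
    edgePoint ρ q r c = trianglePoint p q r (1 - edgeParam ρ q r c) (edgeParam ρ q r c) := by
  simp only [edgePoint, AffineMap.lineMap_apply, trianglePoint, vsub_eq_sub, vadd_eq_add]
  module

lemma lineMap_trianglePoint (p q r : Deck) (θ z θ' z' τ : ℝ) :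
    AffineMap.lineMap (trianglePoint p q r θ z) (trianglePoint p q r θ' z') τ =
      trianglePoint p q r ((1 - τ) * θ + τ * θ') ((1 - τ) * z + τ * z') := by
  simp only [AffineMap.lineMap_apply, trianglePoint, vsub_eq_sub, vadd_eq_add]
  module

/-- The point of level `c` on the path from `p` to `r` that consists of the edges from `p` to `q`
and from `q` to `r`. -/
noncomputable def detourPoint (ρ : Deck → ℝ → ℝ) (p q r : Deck) (c : ℝ) : Plane :=
  open Classical in if c ≤ ρ q 0 then edgePoint ρ p q c else edgePoint ρ q r c

lemma detourPoint_of_le {ρ : Deck → ℝ → ℝ} (p r : Deck) {q : Deck} {c : ℝ} (hc : c ≤ ρ q 0) :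
    detourPoint ρ p q r c = edgePoint ρ p q c := if_pos hc

variable [LinearOrder Deck] {ρ : Deck → ℝ → ℝ} {T : OneVertexTriangulation}

/-- The part in the triangle `t` of the level `c` of the defining function. -/
def triangleLevel (T : OneVertexTriangulation) (ρ : Deck → ℝ → ℝ) (t : Finset Plane) (c : ℝ) :
    Set Plane :=
  convexHull ℝ (skeletonLevel T ρ c ∩ convexHull ℝ (t : Set Plane))

lemma triangleLevel_subset (T : OneVertexTriangulation) (ρ : Deck → ℝ → ℝ) (t : Finset Plane)
    (c : ℝ) : triangleLevel T ρ t c ⊆ convexHull ℝ t :=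
  convexHull_min inter_subset_right (convex_convexHull ℝ _)

/-- `t` is a triangle of the triangulation with vertices `p < q < r`. -/
structure IsOrderedTriangle (T : OneVertexTriangulation) (p q r : Deck) (t : Finset Plane) :
    Prop where
  lt₁ : p < q
  lt₂ : q < r
  mem : t ∈ T.complex.faces
  coe_eq : (t : Set Plane) = {pt p, pt q, pt r}

lemma OneVertexTriangulation.IsTriangle.exists_isOrderedTriangle {t : Finset Plane}
    (ht : T.IsTriangle t) : ∃ p q r, IsOrderedTriangle T p q r t := by
  obtain ⟨hf, hcard⟩ := ht
  obtain ⟨u, rfl⟩ := exists_map_pt_eq_of_mem_faces hf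
  rw [Finset.card_map] at hcard
  let f := u.orderEmbOfFin hcard
  have hu : (u : Set Deck) = {f 0, f 1, f 2} := by
    rw [← Finset.range_orderEmbOfFin u hcard]
    ext
    simp only [mem_range, Fin.exists_fin_succ, mem_insert_iff, mem_singleton_iff, eq_comm, f]
    simp
  refine ⟨f 0, f 1, f 2, f.strictMono (by decide), f.strictMono (by decide), hf, ?_⟩
  rw [Finset.coe_map, hu]
  simp [image_insert_eq]

namespace IsOrderedTriangle

variable {p q r : Deck} {t : Finset Plane} (h : IsOrderedTriangle T p q r t)
include h

lemma lt : p < r := h.lt₁.trans h.lt₂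

lemma mem_convexHull {x : Plane} : x ∈ convexHull ℝ (t : Set Plane) ↔
    ∃ θ z : ℝ, 0 ≤ θ ∧ 0 ≤ z ∧ θ + z ≤ 1 ∧ x = trianglePoint p q r θ z := by
  rw [h.coe_eq, mem_convexHull_triple]
  rfl

lemma pt_mem_iff {v : Deck} : pt v ∈ t ↔ v = p ∨ v = q ∨ v = r := by
  rw [← Finset.mem_coe, h.coe_eq]
  simp only [mem_insert_iff, mem_singleton_iff, pt_injective.eq_iff]

lemma isTriangle : T.IsTriangle t := by
  classical
  have ht : t = {pt p, pt q, pt r} := Finset.coe_injective (by simp [h.coe_eq])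
  refine ⟨h.mem, ht ▸ Finset.card_eq_three.2 ⟨_, _, _, ?_, ?_, ?_, rfl⟩⟩
  exacts [pt_injective.ne h.lt₁.ne, pt_injective.ne h.lt.ne, pt_injective.ne h.lt₂.ne]

lemma isEdge {v w : Deck} (hv : pt v ∈ t) (hw : pt w ∈ t) : T.IsEdge v w := by
  classical
  refine ⟨{pt v, pt w}, T.complex.down_closed h.mem ?_ (Finset.insert_nonempty _ _), by simp⟩
  exact Finset.insert_subset hv (Finset.singleton_subset_iff.2 hw)

lemma range_eq : range (pt ∘ ![p, q, r]) = t := by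
  rw [h.coe_eq]
  ext; simp [Fin.exists_fin_succ, eq_comm]

lemma affineIndependent : AffineIndependent ℝ (pt ∘ ![p, q, r]) := by
  have hmono : StrictMono ![p, q, r] := by simp [h.lt₁, h.lt₂]
  exact .of_set_of_injective (h.range_eq ▸ T.complex.indep h.mem)
    (pt_injective.comp hmono.injective)

lemma linearIndependent : LinearIndependent ℝ ![pt q - pt p, pt r - pt p] := by
  have hind := (affineIndependent_iff_linearIndependent_vsub ℝ _ 0).1 h.affineIndependent
  have hcomp : ![pt q - pt p, pt r - pt p] =
      (fun i : {i : Fin 3 // i ≠ 0} => (pt ∘ ![p, q, r]) i -ᵥ (pt ∘ ![p, q, r]) 0) ∘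
        ![⟨1, by decide⟩, ⟨2, by decide⟩] := by
    ext i : 1
    fin_cases i <;> rfl
  rw [hcomp]
  exact hind.comp _ (by decide)

lemma exists_eq_trianglePoint (x : Plane) : ∃ θ z : ℝ, x = trianglePoint p q r θ z := by
  have htop := h.linearIndependent.span_eq_top_of_card_eq_finrank' (by simp)
  have hmem : x - pt p ∈ Submodule.span ℝ (range ![pt q - pt p, pt r - pt p]) :=
    htop ▸ Submodule.mem_top
  rw [Matrix.range_cons_cons_empty, Submodule.mem_span_pair] at hmem
  obtain ⟨θ, z, he⟩ := hmem
  exact ⟨θ, z, by rw [trianglePoint, add_assoc, he, add_sub_cancel]⟩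

lemma trianglePoint_inj {θ z θ' z' : ℝ} :
    trianglePoint p q r θ z = trianglePoint p q r θ' z' ↔ θ = θ' ∧ z = z' := by
  simp only [trianglePoint, add_assoc, add_right_inj]
  exact ⟨fun he => h.linearIndependent.eq_of_pair he, fun ⟨hθ, hz⟩ => by rw [hθ, hz]⟩

end IsOrderedTriangle

namespace IsOrderedTriangle

variable [IsOrderedAddMonoid Deck] {p q r : Deck} {t : Finset Plane}
  (h : IsOrderedTriangle T p q r t) (hρ : IsAllowedAction ρ)
include h hρ

lemma detourPoint_of_ge {c : ℝ} (hc : ρ q 0 ≤ c) :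
    detourPoint ρ p q r c = edgePoint ρ q r c := by
  rcases hc.eq_or_lt with rfl | hc
  · rw [detourPoint_of_le p r le_rfl, hρ.edgePoint_right, hρ.edgePoint_left h.lt₂]
  · exact if_neg hc.not_ge

lemma continuous_detourPoint : Continuous (detourPoint ρ p q r) := by
  classical
  have hif : detourPoint ρ p q r =
      fun c => if c ≤ ρ q 0 then edgePoint ρ p q c else edgePoint ρ q r c := by
    ext1 c
    simp only [detourPoint]
  rw [hif]
  refine (hρ.continuous_edgePoint p q).if_le (hρ.continuous_edgePoint q r) continuous_id
    continuous_const ?_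
  rintro _ rfl
  exact (hρ.edgePoint_right p q).trans (hρ.edgePoint_left h.lt₂).symm

lemma edgePoint_mem_inter {v w : Deck} (hvw : v < w) (hv : pt v ∈ t) (hw : pt w ∈ t) {c : ℝ}
    (hc : c ∈ Icc (ρ v 0) (ρ w 0)) :
    edgePoint ρ v w c ∈ skeletonLevel T ρ c ∩ convexHull ℝ (t : Set Plane) :=
  ⟨hρ.mem_skeletonLevel.2 ⟨v, w, hvw, h.isEdge hv hw, hc, rfl⟩,
    (convex_convexHull ℝ _).segment_subset (subset_convexHull ℝ _ hv) (subset_convexHull ℝ _ hw)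
      (hρ.edgePoint_mem_segment hvw hc)⟩

lemma skeletonLevel_inter {c : ℝ} (hc : c ∈ Icc (ρ p 0) (ρ r 0)) :
    skeletonLevel T ρ c ∩ convexHull ℝ (t : Set Plane) =
      {edgePoint ρ p r c, detourPoint ρ p q r c} := by
  have hp := h.pt_mem_iff.2 (.inl rfl)
  have hq := h.pt_mem_iff.2 (.inr (.inl rfl))
  have hr := h.pt_mem_iff.2 (.inr (.inr rfl))
  apply Subset.antisymm
  · rintro x ⟨hx, hxt⟩
    obtain ⟨v, w, hvw, hv, hw, hcv, rfl⟩ := hρ.exists_eq_edgePoint_of_mem_convexHull hx h.mem hxt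
    rcases hvw.eq_or_lt with rfl | hvw
    · obtain rfl := hcv.2.antisymm hcv.1
      rw [edgePoint_self]
      rcases h.pt_mem_iff.1 hv with rfl | rfl | rfl
      · exact .inl (hρ.edgePoint_left h.lt).symm
      · exact .inr ((detourPoint_of_le p r le_rfl).trans (hρ.edgePoint_right p _)).symm
      · exact .inl (hρ.edgePoint_right p _).symm
    · rcases h.pt_mem_iff.1 hv with rfl | rfl | rfl <;>
        rcases h.pt_mem_iff.1 hw with rfl | rfl | rfl
      · exact absurd hvw (lt_irrefl _)
      · exact .inr (detourPoint_of_le v r hcv.2).symm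
      · exact .inl rfl
      · exact absurd hvw h.lt₁.not_gt
      · exact absurd hvw (lt_irrefl _)
      · exact .inr (h.detourPoint_of_ge hρ hcv.1).symm
      · exact absurd hvw h.lt.not_gt
      · exact absurd hvw h.lt₂.not_gt
      · exact absurd hvw (lt_irrefl _)
  · rintro x (rfl | rfl)
    · exact h.edgePoint_mem_inter hρ h.lt hp hr hc
    · rcases le_total c (ρ q 0) with hcq | hcq
      · rw [detourPoint_of_le p r hcq]
        exact h.edgePoint_mem_inter hρ h.lt₁ hp hq ⟨hc.1, hcq⟩
      · rw [h.detourPoint_of_ge hρ hcq]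
        exact h.edgePoint_mem_inter hρ h.lt₂ hq hr ⟨hcq, hc.2⟩

lemma mem_triangleLevel_iff {c : ℝ} (hc : c ∈ Icc (ρ p 0) (ρ r 0)) {x : Plane} :
    x ∈ triangleLevel T ρ t c ↔ ∃ τ ∈ Icc (0 : ℝ) 1,
      x = AffineMap.lineMap (edgePoint ρ p r c) (detourPoint ρ p q r c) τ := by
  rw [triangleLevel, h.skeletonLevel_inter hρ hc, convexHull_pair, segment_eq_image_lineMap]
  simp only [mem_image, eq_comm]

lemma mem_Icc_of_mem_triangleLevel {c : ℝ} {x : Plane} (hx : x ∈ triangleLevel T ρ t c) :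
    c ∈ Icc (ρ p 0) (ρ r 0) := by
  obtain ⟨y, hy, hyt⟩ := convexHull_nonempty_iff.1 ⟨x, hx⟩
  obtain ⟨v, w, -, hv, hw, hc, -⟩ := hρ.exists_eq_edgePoint_of_mem_convexHull hy h.mem hyt
  have hpv : p ≤ v := by
    rcases h.pt_mem_iff.1 hv with rfl | rfl | rfl
    exacts [le_rfl, h.lt₁.le, h.lt.le]
  have hwr : w ≤ r := by
    rcases h.pt_mem_iff.1 hw with rfl | rfl | rfl
    exacts [h.lt.le, h.lt₂.le, le_rfl]
  exact ⟨((hρ.orbit_le_iff p v).2 hpv).trans hc.1, hc.2.trans ((hρ.orbit_le_iff w r).2 hwr)⟩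

lemma trianglePoint_mem_triangleLevel_iff_of_le {c : ℝ} (hc : c ∈ Icc (ρ p 0) (ρ q 0))
    {θ z : ℝ} : trianglePoint p q r θ z ∈ triangleLevel T ρ t c ↔
      CutsCorner (edgeParam ρ p q c) (edgeParam ρ p r c) θ z := by
  rw [h.mem_triangleLevel_iff hρ ⟨hc.1, hc.2.trans ((hρ.orbit_le_iff q r).2 h.lt₂.le)⟩]
  refine exists_congr fun τ => and_congr_right fun _ => ?_
  rw [detourPoint_of_le p r hc.2, edgePoint_eq_trianglePoint_long ρ p q r,
    edgePoint_eq_trianglePoint_left ρ p q r, lineMap_trianglePoint, h.trianglePoint_inj,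
    mul_zero, zero_add, mul_zero, add_zero]

-- Reversing the order of the line and of the plane turns this into the previous case.
lemma trianglePoint_mem_triangleLevel_iff_of_ge {c : ℝ} (hc : c ∈ Icc (ρ q 0) (ρ r 0))
    {θ z : ℝ} : trianglePoint p q r θ z ∈ triangleLevel T ρ t c ↔
      CutsCorner (1 - edgeParam ρ q r c) (1 - edgeParam ρ p r c) θ (1 - θ - z) := by
  rw [h.mem_triangleLevel_iff hρ ⟨((hρ.orbit_le_iff p q).2 h.lt₁.le).trans hc.1, hc.2⟩]
  refine exists_congr fun τ => and_congr_right fun _ => ?_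
  rw [h.detourPoint_of_ge hρ hc.1, edgePoint_eq_trianglePoint_long ρ p q r,
    edgePoint_eq_trianglePoint_right ρ p q r, lineMap_trianglePoint, h.trianglePoint_inj,
    mul_zero, zero_add]
  refine and_congr_right fun hθ => ?_
  rw [hθ]
  constructor <;> intro hz <;> linarith

lemma lt_of_mem_triangleLevel {c c' θ z z' : ℝ} (hcc' : c < c')
    (hz : trianglePoint p q r θ z ∈ triangleLevel T ρ t c)
    (hz' : trianglePoint p q r θ z' ∈ triangleLevel T ρ t c') : z < z' := by
  have hc := h.mem_Icc_of_mem_triangleLevel hρ hz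
  have hc' := h.mem_Icc_of_mem_triangleLevel hρ hz'
  have hpq := hρ.strictMono_edgeParam h.lt₁
  have hqr := hρ.strictMono_edgeParam h.lt₂
  have hpr := hρ.strictMono_edgeParam h.lt
  have hlong {d : ℝ} (hd : d ∈ Icc (ρ p 0) (ρ r 0)) := (hρ.edgeParam_mem_Icc h.lt).2 hd
  have hleft {d : ℝ} (hd : d ∈ Icc (ρ p 0) (ρ q 0)) := (hρ.edgeParam_mem_Icc h.lt₁).2 hd
  have hright {d : ℝ} (hd : d ∈ Icc (ρ q 0) (ρ r 0)) := (hρ.edgeParam_mem_Icc h.lt₂).2 hd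
  rcases le_or_gt c' (ρ q 0) with hc'q | hqc'
  · have hcq : c ∈ Icc (ρ p 0) (ρ q 0) := ⟨hc.1, hcc'.le.trans hc'q⟩
    rw [h.trianglePoint_mem_triangleLevel_iff_of_le hρ hcq] at hz
    rw [h.trianglePoint_mem_triangleLevel_iff_of_le hρ ⟨hc'.1, hc'q⟩] at hz'
    exact hz.lt hz' (hleft hcq).1 (hpq hcc') (hlong hc).1 (hpr hcc')
  · have hqc'' : c' ∈ Icc (ρ q 0) (ρ r 0) := ⟨hqc'.le, hc'.2⟩
    rw [h.trianglePoint_mem_triangleLevel_iff_of_ge hρ hqc''] at hz'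
    rcases le_or_gt (ρ q 0) c with hqc | hcq
    · rw [h.trianglePoint_mem_triangleLevel_iff_of_ge hρ ⟨hqc, hc.2⟩] at hz
      have := hz'.lt hz (sub_nonneg.2 (hright hqc'').2) (sub_lt_sub_left (hqr hcc') 1)
        (sub_nonneg.2 (hlong hc').2) (sub_lt_sub_left (hpr hcc') 1)
      linarith
    · rw [h.trianglePoint_mem_triangleLevel_iff_of_le hρ ⟨hc.1, hcq.le⟩] at hz
      have hbelow : z < (1 - θ) * edgeParam ρ p r (ρ q 0) :=
        hz.lt_one_sub_mul (hleft ⟨hc.1, hcq.le⟩).1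
          ((hpq hcq).trans_eq (hρ.edgeParam_right p q)) (hlong hc).1 (hpr hcq)
      have habove : 1 - θ - z' < (1 - θ) * (1 - edgeParam ρ p r (ρ q 0)) :=
        hz'.lt_one_sub_mul (sub_nonneg.2 (hright hqc'').2)
          (sub_lt_self 1 ((hρ.edgeParam_left h.lt₂).symm.trans_lt (hqr hqc')))
          (sub_nonneg.2 (hlong hc').2) (sub_lt_sub_left (hpr hqc') 1)
      linarith

lemma eq_of_mem_triangleLevel {c θ z z' : ℝ}
    (hz : trianglePoint p q r θ z ∈ triangleLevel T ρ t c)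
    (hz' : trianglePoint p q r θ z' ∈ triangleLevel T ρ t c) : z = z' := by
  have hc := h.mem_Icc_of_mem_triangleLevel hρ hz
  rcases le_total c (ρ q 0) with hcq | hqc
  · rw [h.trianglePoint_mem_triangleLevel_iff_of_le hρ ⟨hc.1, hcq⟩] at hz hz'
    refine hz.eq hz' fun h0 => ?_
    rw [(hρ.strictMono_edgeParam h.lt₁).injective (h0.trans (hρ.edgeParam_left h.lt₁).symm),
      hρ.edgeParam_left h.lt]
  · rw [h.trianglePoint_mem_triangleLevel_iff_of_ge hρ ⟨hqc, hc.2⟩] at hz hz'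
    refine sub_right_injective (hz.eq hz' fun h1 => ?_)
    rw [(hρ.strictMono_edgeParam h.lt₂).injective
      ((sub_eq_zero.1 h1).symm.trans (hρ.edgeParam_right q r).symm), hρ.edgeParam_right, sub_self]

lemma triangleLevel_unique {c c' : ℝ} {x : Plane} (hx : x ∈ triangleLevel T ρ t c)
    (hx' : x ∈ triangleLevel T ρ t c') : c = c' := by
  obtain ⟨θ, z, -, -, -, rfl⟩ := h.mem_convexHull.1 (triangleLevel_subset T ρ t c hx)
  rcases lt_trichotomy c c' with hlt | heq | hlt
  · exact absurd (h.lt_of_mem_triangleLevel hρ hlt hx hx') (lt_irrefl z)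
  · exact heq
  · exact absurd (h.lt_of_mem_triangleLevel hρ hlt hx' hx) (lt_irrefl z)

lemma exists_mem_triangleLevel {x : Plane} (hx : x ∈ convexHull ℝ (t : Set Plane)) :
    ∃ c, x ∈ triangleLevel T ρ t c := by
  obtain ⟨θ, z, hθ, hz, hs, rfl⟩ := h.mem_convexHull.1 hx
  have hpq := (hρ.orbit_le_iff p q).2 h.lt₁.le
  have hqr := (hρ.orbit_le_iff q r).2 h.lt₂.le
  have hθ1 : θ ∈ Icc (0 : ℝ) 1 := ⟨hθ, by linarith⟩
  rcases le_total z ((1 - θ) * edgeParam ρ p r (ρ q 0)) with hle | hge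
  · obtain ⟨c, hc, hcut⟩ := exists_cutsCorner hpq (hρ.continuous_edgeParam p q)
      (hρ.continuous_edgeParam p r) (hρ.strictMono_edgeParam h.lt₁).monotone
      (hρ.edgeParam_left h.lt₁) (hρ.edgeParam_right p q) (hρ.edgeParam_left h.lt) hθ1 hz hle
    exact ⟨c, (h.trianglePoint_mem_triangleLevel_iff_of_le hρ hc).2 hcut⟩
  · obtain ⟨c, hc, hcut⟩ := exists_cutsCorner (S := fun c => 1 - edgeParam ρ q r (-c))
      (L := fun c => 1 - edgeParam ρ p r (-c)) (z := 1 - θ - z) (neg_le_neg hqr)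
      (continuous_const.sub ((hρ.continuous_edgeParam q r).comp continuous_neg))
      (continuous_const.sub ((hρ.continuous_edgeParam p r).comp continuous_neg))
      (fun _ _ hle => sub_le_sub_left
        ((hρ.strictMono_edgeParam h.lt₂).monotone (neg_le_neg hle)) 1)
      (by simp only [neg_neg, hρ.edgeParam_right, sub_self])
      (by simp only [neg_neg, hρ.edgeParam_left h.lt₂, sub_zero])
      (by simp only [neg_neg, hρ.edgeParam_right, sub_self]) hθ1 (by linarith)
      (by simp only [neg_neg]; linarith)
    exact ⟨-c, (h.trianglePoint_mem_triangleLevel_iff_of_ge hρ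
      ⟨le_neg_of_le_neg hc.2, neg_le_of_neg_le hc.1⟩).2 hcut⟩

end IsOrderedTriangle

lemma exists_mem_skeletonLevel_of_mem_segment (ρ : Deck → ℝ → ℝ) {p q : Deck} (hpq : p < q)
    (he : T.IsEdge p q) {x : Plane} (hx : x ∈ segment ℝ (pt p) (pt q)) :
    ∃ c, x ∈ skeletonLevel T ρ c := by
  rw [segment_eq_image_lineMap] at hx
  obtain ⟨u, hu, rfl⟩ := hx
  exact ⟨_, p, q, hpq, he, u, hu, rfl, rfl⟩

lemma exists_mem_skeletonLevel_of_ssubset (ρ : Deck → ℝ → ℝ) {t s : Finset Plane}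
    (ht : T.IsTriangle t) (hst : s ⊂ t) {x : Plane} (hx : x ∈ convexHull ℝ (s : Set Plane)) :
    ∃ c, x ∈ skeletonLevel T ρ c := by
  classical
  obtain ⟨y, hyt, hys⟩ := Finset.exists_of_ssubset hst
  have hcard : (t.erase y).card = 2 := by rw [Finset.card_erase_of_mem hyt, ht.2]
  have hface : t.erase y ∈ T.complex.faces :=
    T.complex.down_closed ht.1 (Finset.erase_subset y t) (Finset.card_pos.1 (by lia))
  have hxe : x ∈ convexHull ℝ (t.erase y : Set Plane) :=
    convexHull_mono (Finset.coe_subset.2 (Finset.subset_erase.2 ⟨hst.1, hys⟩)) hx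
  obtain ⟨u, hu⟩ := exists_map_pt_eq_of_mem_faces hface
  rw [← hu, Finset.card_map] at hcard
  obtain ⟨v, w, hvw, rfl⟩ : ∃ v w, v < w ∧ u = {v, w} := by
    obtain ⟨v, w, hne, rfl⟩ := Finset.card_eq_two.1 hcard
    rcases hne.lt_or_gt with hlt | hlt
    exacts [⟨v, w, hlt, rfl⟩, ⟨w, v, hlt, Finset.pair_comm v w⟩]
  have hcoe : ((t.erase y : Finset Plane) : Set Plane) = {pt v, pt w} := by
    rw [← hu]
    simp
  rw [hcoe, convexHull_pair] at hxe
  exact exists_mem_skeletonLevel_of_mem_segment ρ hvw ⟨_, hface, hcoe⟩ hxe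

section DefiningFunction

variable [IsOrderedAddMonoid Deck] (hρ : IsAllowedAction ρ)
include hρ

-- A common point of two triangles lies on an edge of each, where the level is determined by the
-- 1-skeleton.
lemma IsAllowedAction.triangleLevel_unique {t t' : Finset Plane} (ht : T.IsTriangle t)
    (ht' : T.IsTriangle t') {c c' : ℝ} {x : Plane} (hx : x ∈ triangleLevel T ρ t c)
    (hx' : x ∈ triangleLevel T ρ t' c') : c = c' := by
  classical
  obtain ⟨p, q, r, h⟩ := ht.exists_isOrderedTriangle
  obtain ⟨p', q', r', h'⟩ := ht'.exists_isOrderedTriangle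
  by_cases htt : t = t'
  · subst htt
    exact h.triangleLevel_unique hρ hx hx'
  · have hxt := triangleLevel_subset T ρ t c hx
    have hxt' := triangleLevel_subset T ρ t' c' hx'
    have hinter : x ∈ convexHull ℝ ((t ∩ t' : Finset Plane) : Set Plane) := by
      rw [Finset.coe_inter]
      exact T.complex.inter_subset_convexHull ht.1 ht'.1 ⟨hxt, hxt'⟩
    have hssub : t ∩ t' ⊂ t := by
      refine Finset.inter_subset_left.ssubset_of_ne fun heq => htt ?_
      exact Finset.eq_of_subset_of_card_le (Finset.inter_eq_left.1 heq) (ht'.2.trans ht.2.symm).le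
    obtain ⟨d, hd⟩ := exists_mem_skeletonLevel_of_ssubset ρ ht hssub hinter
    exact (h.triangleLevel_unique hρ hx (subset_convexHull ℝ _ ⟨hd, hxt⟩)).trans
      (h'.triangleLevel_unique hρ hx' (subset_convexHull ℝ _ ⟨hd, hxt'⟩)).symm

lemma IsAllowedAction.definingFunction_eq {t : Finset Plane} (ht : T.IsTriangle t) {c : ℝ}
    {x : Plane} (hx : x ∈ triangleLevel T ρ t c) : definingFunction T ρ x = c := by
  obtain ⟨t', ht', hx'⟩ := Classical.epsilon_spec
    (p := fun c : ℝ => ∃ t : Finset Plane, T.IsTriangle t ∧ x ∈ triangleLevel T ρ t c)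
    ⟨c, t, ht, hx⟩
  exact hρ.triangleLevel_unique ht' ht hx' hx

namespace IsOrderedTriangle

variable {p q r : Deck} {t : Finset Plane} (h : IsOrderedTriangle T p q r t)
include h

lemma mem_triangleLevel_definingFunction {x : Plane} (hx : x ∈ convexHull ℝ (t : Set Plane)) :
    x ∈ triangleLevel T ρ t (definingFunction T ρ x) := by
  obtain ⟨c, hc⟩ := h.exists_mem_triangleLevel hρ hx
  rwa [hρ.definingFunction_eq h.isTriangle hc]

lemma definingFunction_lt {θ z z' : ℝ} (hθ : 0 ≤ θ) (hz : 0 ≤ z) (hzz' : z < z')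
    (hz' : θ + z' ≤ 1) :
    definingFunction T ρ (trianglePoint p q r θ z) <
      definingFunction T ρ (trianglePoint p q r θ z') := by
  have hlevel := h.mem_triangleLevel_definingFunction hρ
    (h.mem_convexHull.2 ⟨θ, z, hθ, hz, by linarith, rfl⟩)
  have hlevel' := h.mem_triangleLevel_definingFunction hρ
    (h.mem_convexHull.2 ⟨θ, z', hθ, hz.trans hzz'.le, hz', rfl⟩)
  refine lt_of_le_of_ne (not_lt.1 fun hlt => ?_) fun heq => ?_
  · exact hzz'.not_gt (h.lt_of_mem_triangleLevel hρ hlt hlevel' hlevel)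
  · exact hzz'.ne (h.eq_of_mem_triangleLevel hρ hlevel (heq ▸ hlevel'))

-- The preimage of a closed set is the image of a compact set under `(c, τ) ↦` the point with
-- parameter `τ` on the segment of level `c`.
lemma continuousOn_definingFunction :
    ContinuousOn (definingFunction T ρ) (convexHull ℝ (t : Set Plane)) := by
  let Φ : ℝ × ℝ → Plane := fun y =>
    AffineMap.lineMap (edgePoint ρ p r y.1) (detourPoint ρ p q r y.1) y.2
  have hΦ : Continuous Φ := by
    have hlong := hρ.continuous_edgePoint p r
    have hdetour := h.continuous_detourPoint hρ
    simp only [Φ, AffineMap.lineMap_apply, vsub_eq_sub, vadd_eq_add]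
    fun_prop
  rw [continuousOn_iff_isClosed]
  intro C hC
  refine ⟨Φ '' ((Icc (ρ p 0) (ρ r 0) ∩ C) ×ˢ Icc 0 1),
    (((isCompact_Icc.inter_right hC).prod isCompact_Icc).image hΦ).isClosed, ?_⟩
  ext x
  refine and_congr_left fun hx => ⟨fun hxC => ?_, ?_⟩
  · have hlevel := h.mem_triangleLevel_definingFunction hρ hx
    have hc := h.mem_Icc_of_mem_triangleLevel hρ hlevel
    obtain ⟨τ, hτ, heq⟩ := (h.mem_triangleLevel_iff hρ hc).1 hlevel
    exact ⟨(_, τ), ⟨⟨hc, hxC⟩, hτ⟩, heq.symm⟩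
  · rintro ⟨⟨c, τ⟩, ⟨⟨hc, hcC⟩, hτ⟩, rfl⟩
    rw [mem_preimage, hρ.definingFunction_eq h.isTriangle
      ((h.mem_triangleLevel_iff hρ hc).2 ⟨τ, hτ, rfl⟩)]
    exact hcC

end IsOrderedTriangle

end DefiningFunction

end Triangles

/-! ### One-vertex triangulations of the torus -/

section SimplicialComplex

open Set Geometry

lemma exists_affineMap_eq_one {k V P : Type*} [DivisionRing k] [AddCommGroup V] [Module k V]
    [AddTorsor V P] {s : Set P} (hs : AffineIndependent k ((↑) : s → P)) {v : P} (hv : v ∈ s) :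
    ∃ f : P →ᵃ[k] k, f v = 1 ∧ ∀ w ∈ s, w ≠ v → f w = 0 := by
  obtain ⟨t, hst, hind, htop⟩ := exists_subset_affineIndependent_affineSpan_eq_top hs
  let b : AffineBasis t k P := ⟨(↑), hind, by rwa [Subtype.range_coe]⟩
  refine ⟨b.coord ⟨v, hst hv⟩, b.coord_apply_eq _, fun w hw hwv => ?_⟩
  exact b.coord_apply_ne (j := ⟨w, hst hw⟩) fun h => hwv (congrArg Subtype.val h).symm

variable {E : Type*} [AddCommGroup E] [Module ℝ E] {K : SimplicialComplex ℝ E}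

lemma lineMap_notMem_convexHull {s ε : Finset E} (hs : s ∈ K.faces) (hε : ε ∈ K.faces) {x v : E}
    (hx : x ∈ convexHull ℝ (s : Set E)) (hv : v ∈ s) (hvε : v ∉ ε) {u : ℝ} (hu : 0 < u)
    (hu1 : u ≤ 1) : AffineMap.lineMap x v u ∉ convexHull ℝ (ε : Set E) := by
  intro hy
  obtain ⟨f, hfv, hf⟩ := exists_affineMap_eq_one (K.indep hs) hv
  have hy_face : AffineMap.lineMap x v u ∈ convexHull ℝ (s ∩ ε : Set E) :=
    K.inter_subset_convexHull hs hε
      ⟨(convex_convexHull ℝ _).lineMap_mem hx (subset_convexHull ℝ _ hv) ⟨hu.le, hu1⟩, hy⟩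
  have hfy : f (AffineMap.lineMap x v u) = 0 :=
    convexHull_min (fun w hw => hf w hw.1 fun h : w = v => hvε (h ▸ hw.2))
      ((convex_singleton (0 : ℝ)).affine_preimage f) hy_face
  have hfx : 0 ≤ f x := by
    refine convexHull_min (fun w hw => ?_) ((convex_Ici (0 : ℝ)).affine_preimage f) hx
    rcases eq_or_ne w v with rfl | hwv
    exacts [hfv.ge.trans' zero_le_one, (hf w hw hwv).ge]
  rw [AffineMap.apply_lineMap, AffineMap.lineMap_apply_module, hfv, smul_eq_mul, smul_eq_mul] at hfy
  linarith [mul_nonneg (sub_nonneg.2 hu1) hfx]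

section AffineBasis

lemma mem_convexHull_image_compl_singleton {ι : Type*} [Finite ι] (b : AffineBasis ι ℝ E) {x : E}
    (hx : ∀ i, 0 ≤ b.coord i x) {i : ι}
    (hi : b.coord i x = 0) : x ∈ convexHull ℝ (b '' {i}ᶜ) := by
  classical
  have := Fintype.ofFinite ι
  have hsum : ∑ j ∈ Finset.univ.erase i, b.coord j x = 1 := by
    rw [Finset.sum_erase (f := fun j => b.coord j x) _ hi, b.sum_coord_apply_eq_one]
  have hcomb : ∑ j ∈ Finset.univ.erase i, b.coord j x • b j = x := by
    rw [Finset.sum_erase _ (by rw [hi, zero_smul]), b.linear_combination_coord_eq_self]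
  rw [← hcomb]
  exact (convex_convexHull ℝ _).sum_mem (fun j _ => hx j) hsum fun j hj =>
    subset_convexHull ℝ _ (mem_image_of_mem b (Finset.ne_of_mem_erase hj))

variable {ι : Type*} [Fintype ι] (b : AffineBasis ι ℝ E)

lemma exists_lineMap_centroid_mem_convexHull {v : E} (hv : v ∉ convexHull ℝ (range b)) :
    ∃ i, ∃ u ∈ Ioc (0 : ℝ) 1,
      AffineMap.lineMap (Finset.univ.centroid ℝ b) v u ∈ convexHull ℝ (b '' {i}ᶜ) := by
  have := b.nonempty
  obtain ⟨i, hi⟩ := Finite.exists_min fun j => b.coord j v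
  have hneg : b.coord i v < 0 := by
    by_contra! hnonneg
    exact hv (b.convexHull_eq_nonneg_coord ▸ fun j => hnonneg.trans (hi j))
  set κ : ℝ := (Finset.univ.card (α := ι) : ℝ)⁻¹
  have hκ : 0 < κ := inv_pos.2 (Nat.cast_pos.2 (Finset.card_pos.2 Finset.univ_nonempty))
  have hpos : 0 < κ - b.coord i v := by linarith
  have hu : κ / (κ - b.coord i v) ∈ Ioc (0 : ℝ) 1 :=
    ⟨div_pos hκ hpos, (div_le_one hpos).2 (by linarith)⟩
  have hcoord (j : ι) (u : ℝ) : b.coord j (AffineMap.lineMap (Finset.univ.centroid ℝ b) v u) =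
      (1 - u) * κ + u * b.coord j v := by
    rw [AffineMap.apply_lineMap, AffineMap.lineMap_apply_module,
      b.coord_apply_centroid (Finset.mem_univ j), smul_eq_mul, smul_eq_mul]
  have hzero : b.coord i (AffineMap.lineMap (Finset.univ.centroid ℝ b) v
      (κ / (κ - b.coord i v))) = 0 := by
    rw [hcoord]
    field_simp
    ring
  refine ⟨i, _, hu, mem_convexHull_image_compl_singleton b (fun j => ?_) hzero⟩
  rw [← hzero, hcoord, hcoord]
  gcongr
  exact hi j

-- A face that contains the barycenter cannot have a vertex `v` outside the simplex, since the
-- segment from the barycenter to `v` would leave the simplex through one of its facets.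
lemma exists_mem_faces_coe_eq_range (hspace : Finset.univ.centroid ℝ b ∈ K.space)
    (hfacets : ∀ i, ∃ ε ∈ K.faces, (ε : Set E) = b '' {i}ᶜ)
    (hvertices : ∀ v ∈ K.vertices, v ∈ convexHull ℝ (range b) → v ∈ range b) :
    ∃ s ∈ K.faces, (s : Set E) = range b := by
  obtain ⟨s, hs, hxs⟩ := SimplicialComplex.mem_space_iff.1 hspace
  have hsub : (s : Set E) ⊆ range b := by
    intro v hv
    have hvK : v ∈ K.vertices :=
      K.down_closed hs (Finset.singleton_subset_iff.2 hv) (Finset.singleton_nonempty v)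
    by_contra hvb
    obtain ⟨i, u, hu, hmem⟩ :=
      exists_lineMap_centroid_mem_convexHull b fun h => hvb (hvertices v hvK h)
    obtain ⟨ε, hε, hεb⟩ := hfacets i
    have hvε : v ∉ ε := fun h => hvb (image_subset_range b _ (hεb ▸ Finset.mem_coe.2 h))
    exact lineMap_notMem_convexHull hs hε hxs hv hvε hu.1 hu.2 (hεb ▸ hmem)
  refine ⟨s, hs, hsub.antisymm (range_subset_iff.2 fun i => ?_)⟩
  by_contra hi
  have hcoord : b.coord i (Finset.univ.centroid ℝ b) = 0 := by
    refine convexHull_min (fun w hw => ?_)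
      ((convex_singleton (0 : ℝ)).affine_preimage (b.coord i)) hxs
    obtain ⟨j, rfl⟩ := hsub hw
    exact b.coord_apply_ne fun h : i = j => hi (h ▸ hw)
  rw [b.coord_apply_centroid (Finset.mem_univ i), inv_eq_zero, Nat.cast_eq_zero,
    Finset.card_eq_zero] at hcoord
  exact Finset.notMem_empty i (hcoord ▸ Finset.mem_univ i)

end AffineBasis

lemma exists_mem_faces_card_eq_finrank_add_one {E : Type*} [NormedAddCommGroup E]
    [NormedSpace ℝ E] [FiniteDimensional ℝ E] {K : SimplicialComplex ℝ E}
    (hK : K.faces.Countable) (hspace : K.space = univ) :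
    ∃ s ∈ K.faces, s.card = Module.finrank ℝ E + 1 := by
  borelize E
  by_contra! hcard
  have hnull (s : Finset E) (hs : s ∈ K.faces) :
      MeasureTheory.Measure.addHaar (convexHull ℝ (s : Set E)) = 0 := by
    refine MeasureTheory.measure_mono_null (convexHull_subset_affineSpan _)
      (MeasureTheory.Measure.addHaar_affineSubspace _ _ fun htop => hcard s hs ?_)
    have hiff := (K.indep hs).affineSpan_eq_top_iff_card_eq_finrank_add_one
    rw [Subtype.range_coe_subtype, Fintype.card_coe] at hiff
    exact hiff.1 htop
  have huniv : MeasureTheory.Measure.addHaar (univ : Set E) = 0 := by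
    rw [← hspace, SimplicialComplex.space]
    exact (MeasureTheory.measure_biUnion_null_iff hK).2 hnull
  exact NeZero.ne (MeasureTheory.Measure.addHaar : MeasureTheory.Measure E)
    (MeasureTheory.Measure.measure_univ_eq_zero.1 huniv)

end SimplicialComplex

section Structure

open Set

instance : Countable Deck := inferInstanceAs (Countable (ℤ × ℤ))

lemma coe_map_addRight {E : Type*} [AddGroup E] (s : Finset E) (v : E) :
    ((s.map (Equiv.addRight v).toEmbedding : Finset E) : Set E) = (· + v) '' s := by
  simp

namespace OneVertexTriangulation

variable (T : OneVertexTriangulation)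

lemma countable_faces : T.complex.faces.Countable := by
  refine (countable_range fun u : Finset Deck => u.map ⟨pt, pt_injective⟩).mono fun s hs => ?_
  obtain ⟨u, hu⟩ := exists_map_pt_eq_of_mem_faces hs
  exact ⟨u, hu⟩

lemma exists_isTriangle : ∃ t, T.IsTriangle t := by
  obtain ⟨t, ht, hcard⟩ := exists_mem_faces_card_eq_finrank_add_one T.countable_faces T.space_eq
  exact ⟨t, ht, by simpa using hcard⟩

variable {T}

lemma pt_mem_convexHull_iff {s : Finset Plane} (hs : s ∈ T.complex.faces) {g : Deck} :
    pt g ∈ convexHull ℝ (s : Set Plane) ↔ pt g ∈ s :=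
  Geometry.SimplicialComplex.vertex_mem_convexHull_iff
    (by rw [T.vertices_eq]; exact mem_range_self g) hs

lemma IsEdge.reflect {v w : Deck} (hvw : T.IsEdge v w) (c : Deck) :
    T.IsEdge (c - v) (c - w) := by
  obtain ⟨e, he, hcoe⟩ := hvw
  refine ⟨_, T.invariant (c - v - w) e he, ?_⟩
  rw [coe_map_addRight, hcoe, image_pair, ← pt_add, ← pt_add, pair_comm]
  congr 2 <;> abel_nf

end OneVertexTriangulation

variable [LinearOrder Deck] {T : OneVertexTriangulation}

namespace IsOrderedTriangle

variable {p q r : Deck} {t : Finset Plane} (h : IsOrderedTriangle T p q r t)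
include h

lemma coord_eq_of_pt_eq_trianglePoint {g : Deck} {θ z : ℝ} (hg : pt g = trianglePoint p q r θ z)
    (hθ : 0 ≤ θ) (hz : 0 ≤ z) (hθz : θ + z ≤ 1) :
    (θ = 0 ∧ z = 0) ∨ (θ = 1 ∧ z = 0) ∨ (θ = 0 ∧ z = 1) := by
  have hmem : pt g ∈ t := (OneVertexTriangulation.pt_mem_convexHull_iff h.mem).1
    (h.mem_convexHull.2 ⟨θ, z, hθ, hz, hθz, hg⟩)
  rcases h.pt_mem_iff.1 hmem with rfl | rfl | rfl
  · exact .inl (h.trianglePoint_inj.1 (by rw [← hg]; simp [trianglePoint]))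
  · exact .inr (.inl (h.trianglePoint_inj.1 (by rw [← hg]; simp [trianglePoint])))
  · exact .inr (.inr (h.trianglePoint_inj.1 (by rw [← hg]; simp [trianglePoint])))

lemma eq_of_pt_eq_trianglePoint {g : Deck} {θ z : ℝ} (hg : pt g = trianglePoint p q r θ z)
    (hθ : θ ∈ Ico (0 : ℝ) 1) (hz : z ∈ Ico (0 : ℝ) 1) : g = p := by
  have hsum : θ + z ≤ 1 := by
    by_contra! hlt
    have hg' : pt (q + r - g) = trianglePoint p q r (1 - θ) (1 - z) := by
      rw [pt_sub, pt_add, hg]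
      simp only [trianglePoint]
      module
    rcases h.coord_eq_of_pt_eq_trianglePoint hg' (sub_nonneg.2 hθ.2.le) (sub_nonneg.2 hz.2.le)
      (by linarith) with ⟨hθ', -⟩ | ⟨-, hz'⟩ | ⟨hθ', -⟩ <;> linarith [hθ.2, hz.2]
  rcases h.coord_eq_of_pt_eq_trianglePoint hg hθ.1 hz.1 hsum with ⟨rfl, rfl⟩ | ⟨hθ', -⟩ | ⟨-, hz'⟩
  · exact pt_injective (hg.trans (by simp [trianglePoint]))
  · exact absurd hθ' hθ.2.ne
  · exact absurd hz' hz.2.ne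

lemma exists_zsmul_add_zsmul (g : Deck) : ∃ m n : ℤ, g = m • (q - p) + n • (r - q) := by
  obtain ⟨θ, z, hg⟩ := h.exists_eq_trianglePoint (pt (g + p))
  have hfract : pt (g + p - ⌊θ⌋ • (q - p) - ⌊z⌋ • (r - p)) =
      trianglePoint p q r (Int.fract θ) (Int.fract z) := by
    rw [pt_sub, pt_sub, pt_zsmul, pt_zsmul, hg, pt_sub, pt_sub]
    simp only [trianglePoint, Int.fract]
    module
  have hp := h.eq_of_pt_eq_trianglePoint hfract ⟨Int.fract_nonneg θ, Int.fract_lt_one θ⟩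
    ⟨Int.fract_nonneg z, Int.fract_lt_one z⟩
  refine ⟨⌊θ⌋ + ⌊z⌋, ⌊z⌋, ?_⟩
  calc g = g + p - ⌊θ⌋ • (q - p) - ⌊z⌋ • (r - p) - p + ⌊θ⌋ • (q - p) + ⌊z⌋ • (r - p) := by abel
    _ = (⌊θ⌋ + ⌊z⌋) • (q - p) + ⌊z⌋ • (r - q) := by rw [hp]; module

variable [IsOrderedAddMonoid Deck]

lemma translate (g : Deck) :
    IsOrderedTriangle T (p + g) (q + g) (r + g) (t.map (Equiv.addRight (pt g)).toEmbedding) where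
  lt₁ := add_lt_add_left h.lt₁ g
  lt₂ := add_lt_add_left h.lt₂ g
  mem := T.invariant g t h.mem
  coe_eq := by rw [coe_map_addRight, h.coe_eq]; simp [image_insert_eq, pt_add]

-- The reflected edges are translates of edges, so the reflected triangle is bounded by edges and
-- contains no further vertices.
lemma reflect (c : Deck) : ∃ t', IsOrderedTriangle T (c - r) (c - q) (c - p) t' := by
  let e : Plane ≃ᵃ[ℝ] Plane := AffineEquiv.constVSub ℝ (pt c)
  have he (g : Deck) : e (pt g) = pt (c - g) := (pt_sub c g).symm
  have hind := e.affineIndependent_iff.2 h.affineIndependent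
  let b : AffineBasis (Fin 3) ℝ Plane :=
    ⟨_, hind, hind.affineSpan_eq_top_iff_card_eq_finrank_add_one.2 (by simp)⟩
  have hrange : range b = e '' t := by rw [← h.range_eq, ← range_comp]; rfl
  have hfacets (i : Fin 3) : ∃ ε ∈ T.complex.faces, (ε : Set Plane) = b '' {i}ᶜ := by
    obtain ⟨j, k, hjk⟩ : ∃ j k : Fin 3, ∀ l, l ≠ i ↔ l = j ∨ l = k := by decide +revert
    have hcompl : ({i}ᶜ : Set (Fin 3)) = {j, k} := Set.ext hjk
    have hmem (l : Fin 3) : pt (![p, q, r] l) ∈ t := by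
      rw [h.pt_mem_iff]; fin_cases l <;> simp
    obtain ⟨ε, hε, hcoe⟩ := (h.isEdge (hmem j) (hmem k)).reflect c
    exact ⟨ε, hε, by rw [hcoe, hcompl, image_pair, ← he, ← he]; rfl⟩
  have hvertices : ∀ v ∈ T.complex.vertices, v ∈ convexHull ℝ (range b) → v ∈ range b := by
    intro v hv hvb
    obtain ⟨g, rfl⟩ := T.vertices_eq ▸ hv
    rw [hrange] at hvb ⊢
    obtain ⟨x, hx, hxg⟩ := (AffineMap.image_convexHull e.toAffineMap _).ge hvb
    obtain rfl : x = pt (c - g) := by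
      rw [pt_sub, ← hxg]; exact (sub_sub_cancel _ _).symm
    exact ⟨_, (OneVertexTriangulation.pt_mem_convexHull_iff h.mem).1 hx, hxg⟩
  obtain ⟨t', ht', hcoe⟩ :=
    exists_mem_faces_coe_eq_range b (T.space_eq ▸ mem_univ _) hfacets hvertices
  refine ⟨t', sub_lt_sub_left h.lt₂ c, sub_lt_sub_left h.lt₁ c, ht', ?_⟩
  rw [hcoe, hrange, h.coe_eq, image_insert_eq, image_pair, he, he, he, insert_comm, pair_comm,
    insert_comm]

end IsOrderedTriangle

/-- The triangulation consists of the translates of two triangles with a common long edge `a + b`,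
where `a` and `b` are positive generators of the group. -/
structure IsGeneratedBy (T : OneVertexTriangulation) (a b : Deck) : Prop where
  pos_left : 0 < a
  pos_right : 0 < b
  triangle : ∃ t, IsOrderedTriangle T 0 a (a + b) t
  opposite : ∃ t, IsOrderedTriangle T 0 b (a + b) t
  generate : ∀ g, ∃ m n : ℤ, g = m • a + n • b

theorem OneVertexTriangulation.exists_isGeneratedBy [IsOrderedAddMonoid Deck]
    (T : OneVertexTriangulation) : ∃ a b : Deck, IsGeneratedBy T a b := by
  obtain ⟨t, ht⟩ := T.exists_isTriangle
  obtain ⟨p, q, r, h⟩ := ht.exists_isOrderedTriangle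
  have hlong : r - p = q - p + (r - q) := by abel
  obtain ⟨t', h'⟩ : ∃ t', IsOrderedTriangle T 0 (q - p) (q - p + (r - q)) t' := by
    have htrans := h.translate (-p)
    rw [add_neg_cancel, ← sub_eq_add_neg, ← sub_eq_add_neg, hlong] at htrans
    exact ⟨_, htrans⟩
  refine ⟨q - p, r - q, sub_pos.2 h.lt₁, sub_pos.2 h.lt₂, ⟨t', h'⟩, ?_, h.exists_zsmul_add_zsmul⟩
  have hreflect := h'.reflect (q - p + (r - q))
  rwa [sub_self, add_sub_cancel_left, sub_zero] at hreflect

end Structure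

/-! ### Level sets -/

section RealLine

open Set Filter Topology

lemma strictMono_of_strictMonoOn_Icc_intCast {K β : Type*} [Ring K] [LinearOrder K]
    [IsStrictOrderedRing K] [FloorRing K] [Preorder β] {f : K → β}
    (h : ∀ n : ℤ, StrictMonoOn f (Icc (n : K) (n + 1))) : StrictMono f := by
  have hmono : StrictMono fun n : ℤ => f n := strictMono_int_of_lt_succ fun n => by
    have hn := le_add_of_nonneg_right (a := (n : K)) zero_le_one
    simpa only [Int.cast_add, Int.cast_one] using
      h n (left_mem_Icc.2 hn) (right_mem_Icc.2 hn) (lt_add_one _)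
  have hfloor (x : K) : x ∈ Icc (⌊x⌋ : K) (⌊x⌋ + 1) := ⟨Int.floor_le x, (Int.lt_floor_add_one x).le⟩
  intro x y hxy
  rcases (Int.floor_mono hxy.le).eq_or_lt with heq | hlt
  · exact h ⌊x⌋ (hfloor x) (heq ▸ hfloor y) hxy
  · calc
      f x < f (⌊x⌋ + 1) :=
        h ⌊x⌋ (hfloor x) (right_mem_Icc.2 ((hfloor x).1.trans (hfloor x).2))
          (Int.lt_floor_add_one x)
      _ ≤ f ⌊y⌋ := by
        simpa only [Int.cast_add, Int.cast_one] using hmono.monotone (Int.add_one_le_of_lt hlt)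
      _ ≤ f y := (h ⌊y⌋).monotoneOn (left_mem_Icc.2 ((hfloor y).1.trans (hfloor y).2))
          (hfloor y) (hfloor y).1

lemma locallyFinite_Icc_prod_Icc_intCast :
    LocallyFinite fun k : ℤ × ℤ => Icc (k.1 : ℝ) (k.1 + 1) ×ˢ Icc (k.2 : ℝ) (k.2 + 1) := by
  have h : LocallyFinite fun n : ℤ => Icc (n : ℝ) (n + 1) :=
    locallyFinite_Icc_of_tendsto tendsto_intCast_atTop_atTop
      (tendsto_atBot_add_const_right _ _ (tendsto_intCast_atBot_iff.2 tendsto_id))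
  rintro ⟨x, y⟩
  obtain ⟨U, hU, hfU⟩ := h x
  obtain ⟨V, hV, hfV⟩ := h y
  refine ⟨U ×ˢ V, prod_mem_nhds hU hV, (hfU.prod hfV).subset ?_⟩
  rintro ⟨m, n⟩ ⟨⟨u, v⟩, ⟨hu, hv⟩, hu', hv'⟩
  exact ⟨⟨u, hu, hu'⟩, ⟨v, hv, hv'⟩⟩

lemma continuous_of_strictMono_of_apply_eq_const {X Y Z : Type*} [TopologicalSpace X]
    [LinearOrder Y] [TopologicalSpace Y] [OrderTopology Y] [LinearOrder Z] [TopologicalSpace Z]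
    [OrderClosedTopology Z] {F : X → Y → Z} (hF : ∀ y, Continuous fun x => F x y)
    (hmono : ∀ x, StrictMono (F x)) {φ : X → Y} {c : Z} (hφ : ∀ x, F x (φ x) = c) :
    Continuous φ := by
  refine continuous_iff_continuousAt.2 fun x₀ =>
    tendsto_order.2 ⟨fun l hl => ?_, fun l hl => ?_⟩
  · have hlt : F x₀ l < c := hφ x₀ ▸ hmono x₀ hl
    filter_upwards [((hF l).tendsto x₀).eventually_lt_const hlt] with x hx
    exact (hmono x).lt_iff_lt.1 (hx.trans_eq (hφ x).symm)
  · have hlt : c < F x₀ l := hφ x₀ ▸ hmono x₀ hl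
    filter_upwards [((hF l).tendsto x₀).eventually_const_lt hlt] with x hx
    exact (hmono x).lt_iff_lt.1 ((hφ x).trans_lt hx)

end RealLine

section Levels

open Set

lemma OneVertexTriangulation.IsEdge.translate {T : OneVertexTriangulation} {p q : Deck}
    (h : T.IsEdge p q) (g : Deck) : T.IsEdge (p + g) (q + g) := by
  obtain ⟨e, he, hcoe⟩ := h
  refine ⟨_, T.invariant g e he, ?_⟩
  rw [coe_map_addRight, hcoe, image_pair, pt_add, pt_add]

lemma OneVertexTriangulation.IsTriangle.translate {T : OneVertexTriangulation} {t : Finset Plane}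
    (h : T.IsTriangle t) (g : Deck) : T.IsTriangle (t.map (Equiv.addRight (pt g)).toEmbedding) :=
  ⟨T.invariant g t h.1, by rw [Finset.card_map, h.2]⟩

/-- The linear coordinates on the plane in which the triangles of a triangulation generated by `a`
and `b` are the halves of the unit squares with vertices in `ℤ²`, cut along the antidiagonals. The
vertical direction is that of the long edge `a + b`. -/
def planePoint (a b : Deck) (w z : ℝ) : Plane := trianglePoint 0 a (a + b) w z

lemma planePoint_add_intCast (a b : Deck) (w z : ℝ) (m n : ℤ) :
    planePoint a b (w + m) (z + n) = planePoint a b w z + pt (m • a + n • (a + b)) := by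
  rw [planePoint, planePoint, trianglePoint, trianglePoint, pt_add (m • a), pt_zsmul, pt_zsmul,
    pt_zero]
  module

lemma continuous_planePoint (a b : Deck) :
    Continuous fun y : ℝ × ℝ => planePoint a b y.1 y.2 := by
  unfold planePoint trianglePoint
  fun_prop

variable [LinearOrder Deck] {T : OneVertexTriangulation}

namespace IsGeneratedBy

variable {a b : Deck} (h : IsGeneratedBy T a b)
include h

lemma planePoint_inj {w z w' z' : ℝ} :
    planePoint a b w z = planePoint a b w' z' ↔ w = w' ∧ z = z' := by
  obtain ⟨t, ht⟩ := h.triangle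
  exact ht.trianglePoint_inj

lemma exists_eq_planePoint (x : Plane) : ∃ w z, x = planePoint a b w z := by
  obtain ⟨t, ht⟩ := h.triangle
  exact ht.exists_eq_trianglePoint x

lemma exists_eq_zsmul_add_zsmul (g : Deck) : ∃ m n : ℤ, g = m • a + n • (a + b) := by
  obtain ⟨m, n, rfl⟩ := h.generate g
  exact ⟨m - n, n, by rw [sub_smul, smul_add]; abel⟩

end IsGeneratedBy

variable [IsOrderedAddMonoid Deck] {ρ : Deck → ℝ → ℝ}

namespace IsAllowedAction

variable (hρ : IsAllowedAction ρ)
include hρ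

lemma add_mem_skeletonLevel {c : ℝ} {x : Plane} (hx : x ∈ skeletonLevel T ρ c) (g : Deck) :
    x + pt g ∈ skeletonLevel T ρ (ρ g c) := by
  obtain ⟨p, q, hpq, he, u, hu, rfl, rfl⟩ := hx
  refine ⟨p + g, q + g, add_lt_add_left hpq g, he.translate g, u, hu, ?_, ?_⟩
  · simp only [AffineMap.lineMap_apply, pt_add, vsub_eq_sub, vadd_eq_add]
    module
  · rw [← hρ.map_add, add_sub_add_right_eq_sub, add_comm]

lemma add_mem_triangleLevel {t : Finset Plane} {c : ℝ} {x : Plane}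
    (hx : x ∈ triangleLevel T ρ t c) (g : Deck) :
    x + pt g ∈ triangleLevel T ρ (t.map (Equiv.addRight (pt g)).toEmbedding) (ρ g c) := by
  have himage (s : Set Plane) : convexHull ℝ ((· + pt g) '' s) = (· + pt g) '' convexHull ℝ s :=
    ((AffineEquiv.vaddConst ℝ (pt g)).toAffineMap.image_convexHull s).symm
  have hmem : x + pt g ∈ (· + pt g) '' triangleLevel T ρ t c := mem_image_of_mem _ hx
  rw [triangleLevel, ← himage] at hmem
  refine convexHull_mono ?_ hmem
  rintro _ ⟨y, ⟨hy, hyt⟩, rfl⟩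
  refine ⟨hρ.add_mem_skeletonLevel hy g, ?_⟩
  rw [coe_map_addRight, himage]
  exact mem_image_of_mem _ hyt

end IsAllowedAction

namespace IsGeneratedBy

variable {a b : Deck} (h : IsGeneratedBy T a b)
include h

lemma exists_isOrderedTriangle_lower (m n : ℤ) :
    ∃ p q r t, IsOrderedTriangle T p q r t ∧ ∀ w z : ℝ,
      planePoint a b w z = trianglePoint p q r (w - m) (z - n) := by
  obtain ⟨t, ht⟩ := h.triangle
  refine ⟨_, _, _, _, ht.translate (m • a + n • (a + b)), fun w z => ?_⟩
  simp only [planePoint, trianglePoint, pt_add, pt_zsmul, pt_zero]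
  module

lemma exists_isOrderedTriangle_upper (m n : ℤ) :
    ∃ p q r t, IsOrderedTriangle T p q r t ∧ ∀ w z : ℝ,
      planePoint a b w z = trianglePoint p q r (m + 1 - w) ((w - m) + (z - n) - 1) := by
  obtain ⟨t, ht⟩ := h.opposite
  refine ⟨_, _, _, _, ht.translate ((m + 1) • a + n • (a + b)), fun w z => ?_⟩
  simp only [planePoint, trianglePoint, pt_add, pt_zsmul, pt_zero]
  push_cast
  module

lemma exists_mem_convexHull (x : Plane) :
    ∃ p q r t, IsOrderedTriangle T p q r t ∧ x ∈ convexHull ℝ (t : Set Plane) := by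
  obtain ⟨w, z, rfl⟩ := h.exists_eq_planePoint x
  have hw := Int.floor_le w
  have hw' := Int.lt_floor_add_one w
  have hz := Int.floor_le z
  have hz' := Int.lt_floor_add_one z
  rcases le_total ((w - ⌊w⌋) + (z - ⌊z⌋)) 1 with hle | hge
  · obtain ⟨p, q, r, t, ht, he⟩ := h.exists_isOrderedTriangle_lower ⌊w⌋ ⌊z⌋
    exact ⟨p, q, r, t, ht, ht.mem_convexHull.2 ⟨_, _, by linarith, by linarith, hle, he w z⟩⟩
  · obtain ⟨p, q, r, t, ht, he⟩ := h.exists_isOrderedTriangle_upper ⌊w⌋ ⌊z⌋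
    exact ⟨p, q, r, t, ht, ht.mem_convexHull.2 ⟨_, _, by linarith, by linarith, by linarith,
      he w z⟩⟩

lemma exists_le_nsmul (g : Deck) : ∃ n : ℕ, g ≤ n • (a + b) := by
  obtain ⟨m, n, rfl⟩ := h.generate g
  refine ⟨m.natAbs + n.natAbs, ?_⟩
  rw [smul_add, ← natCast_zsmul, ← natCast_zsmul b]
  exact add_le_add (zsmul_le_zsmul_left h.pos_left.le (by omega))
    (zsmul_le_zsmul_left h.pos_right.le (by omega))

variable (hρ : IsAllowedAction ρ)
include hρ

lemma definingFunction_add_pt (x : Plane) (g : Deck) :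
    definingFunction T ρ (x + pt g) = ρ g (definingFunction T ρ x) := by
  obtain ⟨p, q, r, t, ht, hx⟩ := h.exists_mem_convexHull x
  exact hρ.definingFunction_eq (ht.isTriangle.translate g)
    (hρ.add_mem_triangleLevel (ht.mem_triangleLevel_definingFunction hρ hx) g)

lemma definingFunction_planePoint_add_intCast (w z : ℝ) (m n : ℤ) :
    definingFunction T ρ (planePoint a b (w + m) (z + n)) =
      ρ (m • a + n • (a + b)) (definingFunction T ρ (planePoint a b w z)) := by
  rw [planePoint_add_intCast, h.definingFunction_add_pt hρ]

lemma exists_definingFunction_mem_Icc (x : Plane) :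
    ∃ p r, definingFunction T ρ x ∈ Icc (ρ p 0) (ρ r 0) := by
  obtain ⟨p, q, r, t, ht, hx⟩ := h.exists_mem_convexHull x
  exact ⟨p, r, ht.mem_Icc_of_mem_triangleLevel hρ (ht.mem_triangleLevel_definingFunction hρ hx)⟩

lemma strictMono_definingFunction_planePoint (w : ℝ) :
    StrictMono fun z => definingFunction T ρ (planePoint a b w z) := by
  refine strictMono_of_strictMonoOn_Icc_intCast fun n => ?_
  have hw := Int.floor_le w
  have hw' := Int.lt_floor_add_one w
  have hlower : StrictMonoOn (fun z => definingFunction T ρ (planePoint a b w z))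
      (Icc (n : ℝ) (n + 1 - (w - ⌊w⌋))) := by
    obtain ⟨p, q, r, t, ht, he⟩ := h.exists_isOrderedTriangle_lower ⌊w⌋ n
    intro z hz z' hz' hzz'
    simp only [he]
    exact ht.definingFunction_lt hρ (by linarith) (by linarith [hz.1]) (by linarith)
      (by linarith [hz'.2])
  have hupper : StrictMonoOn (fun z => definingFunction T ρ (planePoint a b w z))
      (Icc (n + 1 - (w - ⌊w⌋)) (n + 1 : ℝ)) := by
    obtain ⟨p, q, r, t, ht, he⟩ := h.exists_isOrderedTriangle_upper ⌊w⌋ n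
    intro z hz z' hz' hzz'
    simp only [he]
    exact ht.definingFunction_lt hρ (by linarith) (by linarith [hz.1]) (by linarith)
      (by linarith [hz'.2])
  have hunion := hlower.union hupper (isGreatest_Icc (by linarith)) (isLeast_Icc (by linarith))
  rwa [Icc_union_Icc_eq_Icc (by linarith) (by linarith)] at hunion

lemma continuousOn_definingFunction_planePoint (m n : ℤ) :
    ContinuousOn (fun y : ℝ × ℝ => definingFunction T ρ (planePoint a b y.1 y.2))
      (Icc (m : ℝ) (m + 1) ×ˢ Icc (n : ℝ) (n + 1)) := by
  set Q : Set (ℝ × ℝ) := Icc (m : ℝ) (m + 1) ×ˢ Icc (n : ℝ) (n + 1)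
  have hQ : IsClosed Q := isClosed_Icc.prod isClosed_Icc
  have hsum : Continuous fun y : ℝ × ℝ => (y.1 - m) + (y.2 - n) := by fun_prop
  have hlower : ContinuousOn (fun y : ℝ × ℝ => definingFunction T ρ (planePoint a b y.1 y.2))
      (Q ∩ {y | (y.1 - m) + (y.2 - n) ≤ 1}) := by
    obtain ⟨p, q, r, t, ht, he⟩ := h.exists_isOrderedTriangle_lower m n
    refine (ht.continuousOn_definingFunction hρ).comp (continuous_planePoint a b).continuousOn ?_
    rintro ⟨w, z⟩ ⟨⟨hw, hz⟩, hle⟩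
    exact ht.mem_convexHull.2 ⟨_, _, sub_nonneg.2 hw.1, sub_nonneg.2 hz.1, hle, he w z⟩
  have hupper : ContinuousOn (fun y : ℝ × ℝ => definingFunction T ρ (planePoint a b y.1 y.2))
      (Q ∩ {y | 1 ≤ (y.1 - m) + (y.2 - n)}) := by
    obtain ⟨p, q, r, t, ht, he⟩ := h.exists_isOrderedTriangle_upper m n
    refine (ht.continuousOn_definingFunction hρ).comp (continuous_planePoint a b).continuousOn ?_
    rintro ⟨w, z⟩ ⟨⟨hw, hz⟩, hge⟩
    exact ht.mem_convexHull.2 ⟨_, _, sub_nonneg.2 hw.2, sub_nonneg.2 hge,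
      by linarith [show z ≤ n + 1 from hz.2], he w z⟩
  refine (hlower.union_of_isClosed hupper (hQ.inter (isClosed_le hsum continuous_const))
    (hQ.inter (isClosed_le continuous_const hsum))).mono fun y hy => ?_
  exact (le_total ((y.1 - m) + (y.2 - n)) 1).imp (⟨hy, ·⟩) (⟨hy, ·⟩)

lemma continuous_definingFunction_planePoint :
    Continuous fun y : ℝ × ℝ => definingFunction T ρ (planePoint a b y.1 y.2) := by
  refine locallyFinite_Icc_prod_Icc_intCast.continuous ?_
    (fun k => isClosed_Icc.prod isClosed_Icc)
    (fun k => h.continuousOn_definingFunction_planePoint hρ k.1 k.2)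
  refine eq_univ_of_forall fun y => mem_iUnion.2 ⟨(⌊y.1⌋, ⌊y.2⌋), ?_⟩
  exact ⟨⟨Int.floor_le _, (Int.lt_floor_add_one _).le⟩,
    ⟨Int.floor_le _, (Int.lt_floor_add_one _).le⟩⟩

lemma exists_le_definingFunction_planePoint (g : Deck) (w : ℝ) :
    ∃ z, ρ g 0 ≤ definingFunction T ρ (planePoint a b w z) := by
  obtain ⟨p, r, hp, -⟩ := h.exists_definingFunction_mem_Icc hρ (planePoint a b w 0)
  obtain ⟨n, hn⟩ := h.exists_le_nsmul (g - p)
  have hshift := h.definingFunction_planePoint_add_intCast hρ w 0 0 n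
  rw [zero_smul, Int.cast_zero, add_zero, zero_add, zero_add, natCast_zsmul] at hshift
  refine ⟨(n : ℤ), ?_⟩
  calc
    ρ g 0 ≤ ρ (n • (a + b) + p) 0 := (hρ.orbit_le_iff _ _).2 (sub_le_iff_le_add.1 hn)
    _ = ρ (n • (a + b)) (ρ p 0) := hρ.map_add _ _ _
    _ ≤ ρ (n • (a + b)) (definingFunction T ρ (planePoint a b w 0)) :=
      (hρ.strictMono _).monotone hp
    _ = _ := hshift.symm

lemma exists_definingFunction_planePoint_le (g : Deck) (w : ℝ) :
    ∃ z, definingFunction T ρ (planePoint a b w z) ≤ ρ g 0 := by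
  obtain ⟨p, r, -, hr⟩ := h.exists_definingFunction_mem_Icc hρ (planePoint a b w 0)
  obtain ⟨n, hn⟩ := h.exists_le_nsmul (r - g)
  have hshift := h.definingFunction_planePoint_add_intCast hρ w 0 0 (-n)
  rw [zero_smul, Int.cast_zero, add_zero, zero_add, zero_add, neg_smul, natCast_zsmul] at hshift
  refine ⟨(-n : ℤ), ?_⟩
  calc
    _ = ρ (-(n • (a + b))) (definingFunction T ρ (planePoint a b w 0)) := hshift
    _ ≤ ρ (-(n • (a + b))) (ρ r 0) := (hρ.strictMono _).monotone hr
    _ = ρ (-(n • (a + b)) + r) 0 := (hρ.map_add _ _ _).symm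
    _ ≤ ρ g 0 := (hρ.orbit_le_iff _ _).2 (neg_add_le_iff_le_add.2 (sub_le_iff_le_add.1 hn))

theorem exists_continuous_definingFunction_planePoint_eq_iff {c : ℝ} {g g' : Deck}
    (hc : c ∈ Icc (ρ g 0) (ρ g' 0)) :
    ∃ φ : ℝ → ℝ, Continuous φ ∧
      ∀ w z, definingFunction T ρ (planePoint a b w z) = c ↔ z = φ w := by
  have hmono := h.strictMono_definingFunction_planePoint hρ
  have hcont := h.continuous_definingFunction_planePoint hρ
  have hlevel (w : ℝ) : ∃ z, definingFunction T ρ (planePoint a b w z) = c := by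
    obtain ⟨z, hz⟩ := h.exists_definingFunction_planePoint_le hρ g w
    obtain ⟨z', hz'⟩ := h.exists_le_definingFunction_planePoint hρ g' w
    exact mem_range_of_exists_le_of_exists_ge (hcont.comp (Continuous.prodMk_right w))
      ⟨z, hz.trans hc.1⟩ ⟨z', hc.2.trans hz'⟩
  choose φ hφ using hlevel
  refine ⟨φ, ?_, fun w z =>
    ⟨fun he => (hmono w).injective (he.trans (hφ w).symm), fun he => he ▸ hφ w⟩⟩
  exact continuous_of_strictMono_of_apply_eq_const
    (fun z => hcont.comp (Continuous.prodMk_left z)) hmono hφ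

end IsGeneratedBy

end Levels

/-! ### Leaves -/

section Curves

open Set

lemma isOpenMap_of_continuous_of_injective {F : ℝ → ℝ} (hF : Continuous F)
    (hinj : Function.Injective F) : IsOpenMap F := by
  refine Real.isTopologicalBasis_Ioo_rat.isOpenMap_iff.2 fun s hs => ?_
  obtain ⟨a, b, hab, rfl⟩ : ∃ a b : ℚ, a < b ∧ s = Ioo (a : ℝ) b := by
    simpa only [mem_iUnion, mem_singleton_iff, exists_prop] using hs
  have hle : (a : ℝ) ≤ b := Rat.cast_le.2 hab.le
  rcases hF.strictMono_of_inj hinj with hmono | hanti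
  · rw [hF.continuousOn.image_Ioo_of_strictMonoOn hle (hmono.strictMonoOn _)]
    exact isOpen_Ioo
  · rw [hF.continuousOn.image_Ioo_of_strictAntiOn hle (hanti.strictAntiOn _)]
    exact isOpen_Ioo

-- A lift of the map to the universal cover `ℝ` of the circle is injective, hence open, so that a
-- bijection would be a homeomorphism from the line to a compact space.
lemma not_bijective_of_continuous_real_circle {f : ℝ → Circle} (hf : Continuous f) :
    ¬ Function.Bijective f := by
  intro hbij
  let e : UnitAddCircle ≃ₜ Circle := AddCircle.homeomorphCircle one_ne_zero
  have hg : Continuous (e.symm ∘ f) := e.symm.continuous.comp hf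
  obtain ⟨y, hy⟩ := QuotientAddGroup.mk_surjective ((e.symm ∘ f) 0)
  obtain ⟨F, ⟨-, hF⟩, -⟩ := (AddCircle.isCoveringMap_coe (1 : ℝ)).existsUnique_continuousMap_lifts
    ⟨e.symm ∘ f, hg⟩ 0 y hy
  have hF' : ((↑) : ℝ → UnitAddCircle) ∘ F = e.symm ∘ f := hF
  have hbij' : Function.Bijective (e.symm ∘ f) := e.symm.bijective.comp hbij
  have hFinj : Function.Injective F := (hF' ▸ hbij'.injective).of_comp
  have hopen : IsOpenMap (e.symm ∘ f) :=
    hF' ▸ QuotientAddGroup.isOpenMap_coe.comp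
      (isOpenMap_of_continuous_of_injective F.continuous hFinj)
  let E : ℝ ≃ₜ UnitAddCircle :=
    (Equiv.ofBijective _ hbij').toHomeomorphOfContinuousOpen hg hopen
  exact not_compactSpace_iff.2 inferInstance E.symm.compactSpace

lemma nonempty_range_homeomorph_circle {X : Type*} [TopologicalSpace X] [T2Space X] {γ : ℝ → X}
    (hγ : Continuous γ) {d : ℝ} (hd : d ≠ 0)
    (h : ∀ w w', γ w = γ w' ↔ ∃ j : ℤ, w = w' + j * d) : Nonempty (range γ ≃ₜ Circle) := by
  have hper : Function.Periodic γ d := fun w => (h _ _).2 ⟨1, by rw [Int.cast_one, one_mul]⟩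
  let e : AddCircle d ≃ₜ Circle := AddCircle.homeomorphCircle hd
  have : CompactSpace (AddCircle d) := e.symm.compactSpace
  have hcont : Continuous (hper.lift : AddCircle d → X) :=
    isQuotientMap_quotient_mk'.continuous_iff.2 hγ
  have hinj : Function.Injective (hper.lift : AddCircle d → X) := by
    intro y y' hy
    obtain ⟨w, rfl⟩ := QuotientAddGroup.mk_surjective y
    obtain ⟨w', rfl⟩ := QuotientAddGroup.mk_surjective y'
    obtain ⟨j, rfl⟩ := (h w w').1 hy
    refine sub_eq_zero.1 ?_
    rw [← QuotientAddGroup.mk_sub, add_sub_cancel_left]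
    exact (AddCircle.coe_eq_zero_iff d).2 ⟨j, zsmul_eq_mul d j⟩
  have hrange : range (hper.lift : AddCircle d → X) = range γ :=
    (QuotientAddGroup.mk_surjective.range_comp _).symm
  exact ⟨hrange ▸ (hcont.isClosedEmbedding hinj).isEmbedding.toHomeomorph.symm.trans e⟩

lemma nonempty_range_homeomorph_circle_iff {X : Type*} [TopologicalSpace X] [T2Space X]
    {γ : ℝ → X} (hγ : Continuous γ) {H : AddSubgroup ℤ}
    (h : ∀ w w', γ w = γ w' ↔ ∃ m ∈ H, w = w' + m) :
    Nonempty (range γ ≃ₜ Circle) ↔ H ≠ ⊥ := by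
  constructor
  · rintro ⟨e⟩ rfl
    refine not_bijective_of_continuous_real_circle
      (e.continuous.comp (hγ.subtype_mk mem_range_self))
      (e.bijective.comp ⟨fun w w' hw => ?_, rangeFactorization_surjective⟩)
    obtain ⟨m, hm, rfl⟩ := (h w w').1 (congrArg Subtype.val hw)
    rw [AddSubgroup.mem_bot.1 hm, Int.cast_zero, add_zero]
  · intro hH
    obtain ⟨d, rfl⟩ : ∃ d, H = AddSubgroup.zmultiples d := by
      obtain ⟨d, hd⟩ := Int.subgroup_cyclic H
      exact ⟨d, hd.trans (AddSubgroup.zmultiples_eq_closure d).symm⟩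
    have hd : d ≠ 0 := by
      rintro rfl
      exact hH AddSubgroup.zmultiples_zero_eq_bot
    refine nonempty_range_homeomorph_circle hγ (Int.cast_ne_zero.2 hd) fun w w' => ?_
    rw [h]
    simp [AddSubgroup.mem_zmultiples_iff]

end Curves

section Leaves

open Set Filter Topology

lemma continuous_cover : Continuous cover :=
  ((AddCircle.continuous_mk' 1).comp continuous_fst).prodMk
    ((AddCircle.continuous_mk' 1).comp continuous_snd)

lemma unitAddCircle_coe_eq_coe_iff {u v : ℝ} :
    (u : UnitAddCircle) = v ↔ ∃ n : ℤ, u = v + n := by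
  rw [← sub_eq_zero, ← AddCircle.coe_sub, AddCircle.coe_eq_zero_iff]
  refine exists_congr fun n => ?_
  rw [zsmul_eq_mul, mul_one, eq_comm, sub_eq_iff_eq_add']

lemma cover_eq_cover_iff {x y : Plane} : cover x = cover y ↔ ∃ g : Deck, x = y + pt g := by
  rw [cover, cover, Prod.mk.injEq, unitAddCircle_coe_eq_coe_iff, unitAddCircle_coe_eq_coe_iff]
  constructor
  · rintro ⟨⟨m, hm⟩, n, hn⟩
    exact ⟨(m, n), Prod.ext hm hn⟩
  · rintro ⟨g, rfl⟩
    exact ⟨⟨g.1, rfl⟩, g.2, rfl⟩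

lemma OneVertexTriangulation.cover_chart_eq_cover_chart_iff (T : OneVertexTriangulation)
    {x y : Plane} : cover (T.chart x) = cover (T.chart y) ↔ ∃ g : Deck, x = y + pt g := by
  simp only [cover_eq_cover_iff, ← T.chart_equivariant, T.chart.injective.eq_iff]

/-- The curve on the torus that is the image of the graph of `φ` in the coordinates `planePoint`;
the leaves of the foliation are of this form. -/
def leafCurve (T : OneVertexTriangulation) (a b : Deck) (φ : ℝ → ℝ) (w : ℝ) : Torus :=
  cover (T.chart (planePoint a b w (φ w)))

lemma continuous_leafCurve (T : OneVertexTriangulation) (a b : Deck) {φ : ℝ → ℝ}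
    (hφ : Continuous φ) : Continuous (leafCurve T a b φ) :=
  continuous_cover.comp <| T.chart.continuous.comp <|
    (continuous_planePoint a b).comp (continuous_id.prodMk hφ)

variable [LinearOrder Deck]

lemma IsGeneratedBy.leaf_eq_range_leafCurve {T : OneVertexTriangulation} {a b : Deck}
    (h : IsGeneratedBy T a b) (ρ : Deck → ℝ → ℝ) {x : Plane} {φ : ℝ → ℝ} (hφ : Continuous φ)
    (hlevel : ∀ w z,
      definingFunction T ρ (planePoint a b w z) = definingFunction T ρ x ↔ z = φ w) :
    (fun y => cover (T.chart y)) ''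
        connectedComponentIn {y | definingFunction T ρ y = definingFunction T ρ x} x =
      range (leafCurve T a b φ) := by
  have hgraph : {y | definingFunction T ρ y = definingFunction T ρ x} =
      range fun w => planePoint a b w (φ w) := by
    ext y
    constructor
    · intro hy
      obtain ⟨w, z, rfl⟩ := h.exists_eq_planePoint y
      exact ⟨w, by rw [(hlevel w z).1 hy]⟩
    · rintro ⟨w, rfl⟩
      exact (hlevel w _).2 rfl
  have hcont : Continuous fun w => planePoint a b w (φ w) :=
    (continuous_planePoint a b).comp (continuous_id.prodMk hφ)
  rw [IsPreconnected.connectedComponentIn (hgraph ▸ isPreconnected_range hcont) (by exact rfl),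
    hgraph, ← range_comp]
  rfl

variable {ρ : Deck → ℝ → ℝ} (hρ : IsAllowedAction ρ)
include hρ

namespace IsAllowedAction

lemma neg_apply_eq_self {k : Deck} {c : ℝ} (hk : ρ k c = c) : ρ (-k) c = c := by
  simpa only [hk] using hρ.neg_apply k c

lemma nsmul_apply_eq_self {k : Deck} {c : ℝ} (hk : ρ k c = c) (n : ℕ) : ρ (n • k) c = c := by
  induction n with
  | zero => rw [zero_smul, hρ.map_zero]
  | succ n ih => rw [succ_nsmul, hρ.map_add, hk, ih]

/-- The horizontal components, in the coordinates `planePoint a b`, of the deck transformations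
that fix the level `c`. They are the periods of the leaf of level `c`. -/
def horizontalPeriods (a b : Deck) (c : ℝ) : AddSubgroup ℤ where
  carrier := {m | ∃ n : ℤ, ρ (m • a + n • (a + b)) c = c}
  zero_mem' := ⟨0, by rw [zero_smul, zero_smul, add_zero, hρ.map_zero]⟩
  add_mem' := by
    rintro m m' ⟨n, hn⟩ ⟨n', hn'⟩
    exact ⟨n + n', by rw [add_smul, add_smul, add_add_add_comm, hρ.map_add, hn', hn]⟩
  neg_mem' := by
    rintro m ⟨n, hn⟩
    exact ⟨-n, by rw [neg_smul, neg_smul, ← neg_add, hρ.neg_apply_eq_self hn]⟩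

variable [IsOrderedAddMonoid Deck]

lemma not_archimedean_of_apply_eq_self {c : ℝ} {g g' k : Deck} (hc : c ∈ Icc (ρ g 0) (ρ g' 0))
    (hk0 : k ≠ 0) (hk : ρ k c = c) : ¬ Archimedean Deck := by
  intro hA
  have habs : ρ |k| c = c := by
    rcases abs_choice k with h | h <;> rw [h]
    exacts [hk, hρ.neg_apply_eq_self hk]
  obtain ⟨n, hn⟩ := exists_lt_nsmul (abs_pos.2 hk0) (g' - g)
  have hle : ρ (n • |k| + g) 0 ≤ ρ g' 0 :=
    calc
      ρ (n • |k| + g) 0 = ρ (n • |k|) (ρ g 0) := hρ.map_add _ _ _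
      _ ≤ ρ (n • |k|) c := (hρ.strictMono _).monotone hc.1
      _ = c := hρ.nsmul_apply_eq_self habs n
      _ ≤ ρ g' 0 := hc.2
  exact hn.not_ge (le_sub_iff_add_le.2 ((hρ.orbit_le_iff _ _).1 hle))

-- The orbit of `0` under the multiples of a bounded positive element increases to a fixed point.
lemma exists_apply_eq_self_of_not_archimedean (hA : ¬ Archimedean Deck) :
    ∃ (c : ℝ) (g g' k : Deck), c ∈ Icc (ρ g 0) (ρ g' 0) ∧ k ≠ 0 ∧ ρ k c = c := by
  obtain ⟨x, k, hk, hx⟩ : ∃ x k : Deck, 0 < k ∧ ∀ n : ℕ, n • k < x := by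
    by_contra! h
    exact hA ⟨fun x y hy => h x y hy⟩
  have hmono : Monotone fun n : ℕ => ρ (n • k) 0 := fun m n hmn =>
    (hρ.orbit_le_iff _ _).2 (nsmul_le_nsmul_left hk.le hmn)
  have hle (n : ℕ) : ρ (n • k) 0 ≤ ρ x 0 := (hρ.orbit_le_iff _ _).2 (hx n).le
  have hbdd : BddAbove (range fun n : ℕ => ρ (n • k) 0) := ⟨ρ x 0, forall_mem_range.2 hle⟩
  have hlim := tendsto_atTop_ciSup hmono hbdd
  refine ⟨⨆ n : ℕ, ρ (n • k) 0, 0 • k, x, k, ⟨le_ciSup hbdd 0, ciSup_le hle⟩, hk.ne', ?_⟩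
  refine tendsto_nhds_unique (((hρ.continuous k).tendsto _).comp hlim) ?_
  refine (hlim.comp (tendsto_add_atTop_nat 1)).congr fun n => ?_
  rw [Function.comp_apply, Function.comp_apply, succ_nsmul', hρ.map_add]

end IsAllowedAction

namespace IsGeneratedBy

variable [IsOrderedAddMonoid Deck] {T : OneVertexTriangulation} {a b : Deck}
  (h : IsGeneratedBy T a b)
include h

lemma leafCurve_eq_leafCurve_iff {c : ℝ} {φ : ℝ → ℝ}
    (hlevel : ∀ w z, definingFunction T ρ (planePoint a b w z) = c ↔ z = φ w) (w w' : ℝ) :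
    leafCurve T a b φ w = leafCurve T a b φ w' ↔
      ∃ m ∈ hρ.horizontalPeriods a b c, w = w' + m := by
  have hmem (w : ℝ) : definingFunction T ρ (planePoint a b w (φ w)) = c := (hlevel w _).2 rfl
  rw [leafCurve, leafCurve, T.cover_chart_eq_cover_chart_iff]
  constructor
  · rintro ⟨g, hg⟩
    obtain ⟨m, n, rfl⟩ := h.exists_eq_zsmul_add_zsmul g
    refine ⟨m, ⟨n, ?_⟩, ?_⟩
    · rw [← hmem w', ← h.definingFunction_add_pt hρ, ← hg, hmem, hmem]
    · rw [← planePoint_add_intCast] at hg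
      exact (h.planePoint_inj.1 hg).1
  · rintro ⟨m, ⟨n, hfix⟩, rfl⟩
    have hφ : φ w' + n = φ (w' + m) := by
      rw [← hlevel, h.definingFunction_planePoint_add_intCast hρ, hmem, hfix]
    exact ⟨m • a + n • (a + b), by rw [← planePoint_add_intCast, hφ]⟩

lemma horizontalPeriods_ne_bot_iff (x : Plane) :
    hρ.horizontalPeriods a b (definingFunction T ρ x) ≠ ⊥ ↔
      ∃ k ≠ 0, ρ k (definingFunction T ρ x) = definingFunction T ρ x := by
  obtain ⟨w, z, rfl⟩ := h.exists_eq_planePoint x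
  constructor
  · intro hne
    obtain ⟨⟨m, n, hfix⟩, hm⟩ := AddSubgroup.ne_bot_iff_exists_ne_zero.1 hne
    refine ⟨m • a + n • (a + b), fun hk => hm (Subtype.ext ?_), hfix⟩
    have hpt := planePoint_add_intCast a b w z m n
    rw [hk, pt_zero, add_zero] at hpt
    exact Int.cast_eq_zero.1 (add_eq_left.1 (h.planePoint_inj.1 hpt).1)
  · rintro ⟨k, hk0, hk⟩ hbot
    obtain ⟨m, n, rfl⟩ := h.exists_eq_zsmul_add_zsmul k
    obtain rfl : m = 0 := AddSubgroup.mem_bot.1 (hbot ▸ ⟨n, hk⟩)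
    rw [← h.definingFunction_planePoint_add_intCast hρ, Int.cast_zero, add_zero] at hk
    have hn : z + n = z := (h.strictMono_definingFunction_planePoint hρ w).injective hk
    obtain rfl : n = 0 := Int.cast_eq_zero.1 (add_eq_left.1 hn)
    rw [zero_smul, zero_smul, add_zero] at hk0
    exact hk0 rfl

lemma hasClosedLeaf_iff_exists_apply_eq_self :
    HasClosedLeaf T ρ ↔
      ∃ x, ∃ k ≠ 0, ρ k (definingFunction T ρ x) = definingFunction T ρ x := by
  have hleaf (x : Plane) : Nonempty ((fun y => cover (T.chart y)) '' connectedComponentIn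
      {y | definingFunction T ρ y = definingFunction T ρ x} x ≃ₜ Circle) ↔
      ∃ k ≠ 0, ρ k (definingFunction T ρ x) = definingFunction T ρ x := by
    obtain ⟨g, g', hc⟩ := h.exists_definingFunction_mem_Icc hρ x
    obtain ⟨φ, hφ, hlevel⟩ := h.exists_continuous_definingFunction_planePoint_eq_iff hρ hc
    rw [h.leaf_eq_range_leafCurve ρ hφ hlevel, ← h.horizontalPeriods_ne_bot_iff hρ]
    exact nonempty_range_homeomorph_circle_iff (continuous_leafCurve T a b hφ)
      (h.leafCurve_eq_leafCurve_iff hρ hlevel)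
  simp only [← hleaf]
  exact ⟨fun ⟨_, ⟨x, hL⟩, e⟩ => ⟨x, hL ▸ e⟩, fun ⟨x, e⟩ => ⟨_, ⟨x, rfl⟩, e⟩⟩

end IsGeneratedBy

variable [IsOrderedAddMonoid Deck]

theorem IsAllowedAction.hasClosedLeaf_iff (T : OneVertexTriangulation) :
    HasClosedLeaf T ρ ↔ ¬ Archimedean Deck := by
  obtain ⟨a, b, h⟩ := T.exists_isGeneratedBy
  rw [h.hasClosedLeaf_iff_exists_apply_eq_self hρ]
  constructor
  · rintro ⟨x, k, hk0, hk⟩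
    obtain ⟨g, g', hc⟩ := h.exists_definingFunction_mem_Icc hρ x
    exact hρ.not_archimedean_of_apply_eq_self hc hk0 hk
  · intro hA
    obtain ⟨c, g, g', k, hc, hk0, hk⟩ := hρ.exists_apply_eq_self_of_not_archimedean hA
    obtain ⟨φ, -, hlevel⟩ := h.exists_continuous_definingFunction_planePoint_eq_iff hρ hc
    exact ⟨planePoint a b 0 (φ 0), k, hk0, by rwa [(hlevel 0 _).2 rfl]⟩

end Leaves

end FLOiation

theorem mainTheorem5 [LinearOrder Deck] [IsOrderedAddMonoid Deck]
    (T : FLOiation.OneVertexTriangulation) :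
    (∀ s : ℕ ≃ Deck, s 0 = 0 →
      (FLOiation.HasClosedLeaf T (FLOiation.extendedAction (FLOiation.minimalEmbedding s)) ↔
        ¬ Archimedean Deck)) ∧
    (∀ ρ : Deck → ℝ → ℝ, FLOiation.IsAllowedAction ρ →
      (FLOiation.HasClosedLeaf T ρ ↔ ¬ Archimedean Deck)) :=
  ⟨fun s _ => (FLOiation.isAllowedAction_extendedAction_minimalEmbedding s).hasClosedLeaf_iff T,
    fun _ hρ => hρ.hasClosedLeaf_iff T⟩
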